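/- Let $d\ge 3$, $r\ge 2$ and $n\ge r^2$. For $Q\in\mathbb{C}^{n\times r\times r}$ with slices $Q^{(1)},\dots,Q^{(n)}\in\mathbb{C}^{r\times r}$ let $T=T_Q\in\mathbb{C}^{n^{\times d}}$ be the symmetric tensor ring $T(i_1,\dots,i_d)=\operatorname{tr}(Q^{(i_1)}\cdots Q^{(i_d)})$. Two $d$-tuples of cores are gauge equivalent, $(Q_k)_{k}\sim(Q_k')_{k}$, if there are $L_1,\dots,L_d\in GL(r,\mathbb{C})$ with $Q_k'^{(a)}=L_k^{-1}Q_k^{(a)}L_{k+1}$ for all $k$ and $a$ (indices mod $d$). *Sampling.* A sampling choice consists of $\alpha,\beta,\alpha',\beta'\in[n]^{d-2}$ with $\alpha\ne\beta$, $\alpha'\ne\beta'$, $\{\alpha,\beta\}\ne\{\alpha',\beta'\}$, of $m\in[n]$, and of sets $\Gamma,\Gamma',\Gamma_\gamma\subseteq[n]$ of size $r^2$. The algorithm sees only the entries of the five $n\times r^2$ matrices $T(:,\alpha,\Gamma)$, $T(:,\beta,\Gamma)$, $T(:,\alpha',\Gamma')$, $T(:,\beta',\Gamma')$, $N=T(:,m,\dots,m,\Gamma_\gamma)$,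 where $T(:,\alpha,\Gamma)$ has the entries $T(a,\alpha,c)$, $a\in[n]$, $c\in\Gamma$. *Algorithm BLOSTR-S.* ($A^\dagger$ is the Moore–Penrose inverse; $C_{\langle1\rangle}$ and $C_{[1]}$ are the $n\times r^2$ unfoldings of a core $C$ with $C_{\langle1\rangle}(a,(j-1)r+k)=C_{[1]}(a,(k-1)r+j)=C(a,j,k)$.) 1. Find $E,E'\in\mathbb{C}^{n\times r^2}$ with linearly independent columns which are eigenvectors of $T(:,\alpha,\Gamma)T(:,\beta,\Gamma)^\dagger$ and $T(:,\alpha',\Gamma')T(:,\beta',\Gamma')^\dagger$, respectively, for $r$ distinct nonzero eigenvalues, the columns $t,r+t,\dots,(r-1)r+t$ belonging to the $t$-th eigenvalue. Let $F=E^\dagger E'$, and let $F^{(j,k)}$ be its $r\times r$ submatrix with rows $j,r+j,\dots$ and columns $k,r+k,\dots$. Put $\hat K_1=I$, $\hat K_t=F^{(1,1)}(F^{(t,1)})^{-1}$ for $2\le t\le r$; let $\Pi(\hat K)$ be the $r^2\times r^2$ matrix with entry $(\hat K_t)_{jk}$ at $((j-1)r+t,(k-1)r+t)$ and zeros elsewhere;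 define $\hat Q_1$ by $\hat Q_{1\langle1\rangle}=E\,\Pi(\hat K)^{-1}$. 2. For $k=2,\dots,d$ define $\hat Q_k$ by $\hat Q_{k\langle1\rangle}=N\bigl((I_r\otimes\hat Q_1^{(m)}\cdots\hat Q_{k-2}^{(m)})\,\hat Q_{(k-1)[1]}^{\top}(:,\Gamma_\gamma)\bigr)^\dagger$ (the product is $I_r$ for $k=2$). 3. Find an eigendecomposition $\hat Q_1^{(1)}\hat Q_2^{(1)}\cdots\hat Q_d^{(1)}=Y\operatorname{diag}(\lambda_1,\dots,\lambda_r)Y^{-1}$, and write $\lambda_t=\ell_te^{i\theta_t}$ with $\ell_t\ge0$, $\theta_t\in[0,2\pi)$. 4. Search over $k_1=0$ and $(k_2,\dots,k_r)\in\{0,\dots,d-1\}^{r-1}$: let $\bar Q^{(1)}=Y\operatorname{diag}(\ell_t^{1/d}e^{i(\theta_t+2k_t\pi)/d})_tY^{-1}$ and $\bar Q^{(j)}=(\bar Q^{(1)})^{-(d-1)}\hat Q_1^{(1)}\cdots\hat Q_{d-1}^{(1)}\hat Q_d^{(j)}$ for $j\ge2$, until $\hat Q_1^{(i_1)}\cdots\hat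 Q_d^{(i_d)}=\bar Q^{(i_1)}\cdots\bar Q^{(i_d)}$ for all $(i_1,\dots,i_d)\in[n]^d$. Return $\tilde Q=\bar Q$. A run is completed if all matrices inverted in it are invertible and the search ends. Write $R^\alpha=Q^{(\alpha_1)}\cdots Q^{(\alpha_{d-2})}$. A sampling choice is called nondegenerate if there is at least one core for which $R^\beta,R^{\beta'}$ are invertible, $R^\alpha(R^\beta)^{-1}=U\Lambda U^{-1}$ and $R^{\alpha'}(R^{\beta'})^{-1}=V\Lambda'V^{-1}$ with $\Lambda,\Lambda'$ diagonal with distinct diagonal entries, and $U^{-1}V$ has no zero entry. **Theorem.** Let the entries of $Q$ be random with a joint law $\mu$ on $\mathbb{C}^{n\times r\times r}$ that is absolutely continuous with respect to Lebesgue measure. Then: (a) With probability one, for every sampling choice, every completed run of BLOSTR-S on the observed entries of $T_Q$ returns a core $\tilde Q$ with $(\tilde Q,\dots,\tilde Q)\sim(Q,\dots,Q)$. (b) For every nondegenerate sampling choice, with probability one, BLOSTR-S can always be carried out: $E,E'$ exist; for all such $E,E'$ the blocks $F^{(t,1)}$, $2\le t\le r$, are invertible and the eigendecomposition in step 3 exists;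 and for each such eigendecomposition all the $\bar Q^{(1)}$ are invertible and some $(k_2,\dots,k_r)$ passes the test. (c) A sampling choice is nondegenerate whenever $\alpha,\beta$ differ only in their first index, $\alpha',\beta'$ differ only in their first index, and $\{\alpha_1,\beta_1\}\ne\{\alpha'_1,\beta'_1\}$ (for $d=3$: always); such sampling choices exist. (d) For every sampling choice, at most $5nr^2$ entries of $T$ are observed. -/

import Mathlib

open MeasureTheory Matrix
open scoped Kronecker

namespace TensorRing

/-! ### Tensor rings and gauge equivalence -/

/-- A three-way core of size `n × r × r`, given by its `n` slices. -/
abbrev Core (n r : ℕ) : Type := Fin n → Matrix (Fin r) (Fin r) ℂ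

/-- The core whose entries are the given numbers. -/
def toCore {n r : ℕ} (x : Fin n → Fin r → Fin r → ℂ) : Core n r := fun a => Matrix.of (x a)

/-- The entries of the symmetric tensor ring of order `d` with the single core `Q`. -/
def symTensor {n r : ℕ} (d : ℕ) (Q : Core n r) (i : Fin d → Fin n) : ℂ :=
  (List.ofFn fun k => Q (i k)).prod.trace

/-- Gauge equivalence of two tuples of `d` cores, with cyclic indices. -/
def GaugeEquiv {n r d : ℕ} (Q Q' : Fin d → Core n r) : Prop :=
  ∃ L : Fin d → GL (Fin r) ℂ, ∀ (k : Fin d) (a : Fin n),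
    Q' k a = ((L k)⁻¹ : GL (Fin r) ℂ).val * Q k a * (L (finRotate d k)).val

/-! ### Linear algebra -/

/-- Penrose's four equations: `B` is the Moore-Penrose inverse of `A`. -/
structure IsMoorePenrose {l m : Type*} [Fintype l] [Fintype m]
    (A : Matrix l m ℂ) (B : Matrix m l ℂ) : Prop where
  left : A * B * A = A
  right : B * A * B = B
  hermLeft : (A * B)ᴴ = A * B
  hermRight : (B * A)ᴴ = B * A

theorem IsMoorePenrose.unique {l m : Type*} [Fintype l] [Fintype m]
    {A : Matrix l m ℂ} {B C : Matrix m l ℂ}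
    (hB : IsMoorePenrose A B) (hC : IsMoorePenrose A C) : B = C := by
  have h1 : A * B = A * C := by
    calc A * B = (A * B)ᴴ := hB.hermLeft.symm
      _ = (A * C * (A * B))ᴴ := by rw [← Matrix.mul_assoc, hC.left]
      _ = (A * B)ᴴ * (A * C)ᴴ := Matrix.conjTranspose_mul _ _
      _ = A * C := by rw [hB.hermLeft, hC.hermLeft, ← Matrix.mul_assoc, hB.left]
  have h2 : B * A = C * A := by
    calc B * A = (B * A)ᴴ := hB.hermRight.symm
      _ = (B * A * (C * A))ᴴ := by
        rw [Matrix.mul_assoc, ← Matrix.mul_assoc A, hC.left]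
      _ = (C * A)ᴴ * (B * A)ᴴ := Matrix.conjTranspose_mul _ _
      _ = C * A := by
        rw [hB.hermRight, hC.hermRight, Matrix.mul_assoc, ← Matrix.mul_assoc A, hB.left]
  calc B = B * A * B := hB.right.symm
    _ = C * A * C := by rw [h2, Matrix.mul_assoc, h1, ← Matrix.mul_assoc]
    _ = C := hC.right

open Classical in
/-- The Moore-Penrose inverse `A†`. -/
noncomputable def pinv {l m : Type*} [Fintype l] [Fintype m] (A : Matrix l m ℂ) :
    Matrix m l ℂ :=
  if h : ∃ B, IsMoorePenrose A B then h.choose else 0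

/-- The unfolding `Q_⟨1⟩`: the column of the pair `(j, k)`, which stands for the position
`(j - 1) r + k`, holds the entries `Q(a, j, k)`. -/
def unfoldAngle {n r : ℕ} (Q : Core n r) : Matrix (Fin n) (Fin r × Fin r) ℂ :=
  Matrix.of fun a p => Q a p.1 p.2

/-- The unfolding `Q_[1]`: the column of the pair `(k, j)`, which stands for the position
`(k - 1) r + j`, holds the entries `Q(a, j, k)`. -/
def unfoldSquare {n r : ℕ} (Q : Core n r) : Matrix (Fin n) (Fin r × Fin r) ℂ :=
  Matrix.of fun a p => Q a p.2 p.1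

/-- The inverse of `unfoldAngle`. -/
def foldAngle {n r : ℕ} (M : Matrix (Fin n) (Fin r × Fin r) ℂ) : Core n r :=
  fun a => Matrix.of fun j k => M a (j, k)

/-- `E` is an eigenbasis for the nonzero spectrum of `M`, which consists of `r` distinct
eigenvalues of multiplicity `r`. The column of the pair `(j, t)`, which stands for the position
`(j - 1) r + t`, is the `j`-th chosen eigenvector of the `t`-th eigenvalue. -/
def IsEigenbasis {n r : ℕ} (M : Matrix (Fin n) (Fin n) ℂ)
    (E : Matrix (Fin n) (Fin r × Fin r) ℂ) : Prop :=
  ∃ ev : Fin r → ℂ, Function.Injective ev ∧ (∀ t, ev t ≠ 0) ∧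
    LinearIndependent ℂ E.col ∧ M * E = E * Matrix.diagonal fun p => ev p.2

/-- `H = Y diag(ev) Y⁻¹`. -/
def IsEigendecomposition {r : ℕ} (H Y : Matrix (Fin r) (Fin r) ℂ) (ev : Fin r → ℂ) : Prop :=
  IsUnit Y ∧ H = Y * Matrix.diagonal ev * Y⁻¹

/-- The argument of `z` in `[0, 2π)`. -/
noncomputable def angle (z : ℂ) : ℝ :=
  if 0 ≤ z.arg then z.arg else z.arg + 2 * Real.pi

/-- The `d`-th root `ℓ^{1/d} exp(i (θ + 2kπ) / d)` of `z = ℓ exp(i θ)`, with `θ ∈ [0, 2π)`. -/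
noncomputable def dthRoot (d : ℕ) (z : ℂ) (k : ℕ) : ℂ :=
  ((‖z‖ ^ (1 / (d : ℝ)) : ℝ) : ℂ) *
    Complex.exp (Complex.I * (((angle z + 2 * k * Real.pi) / d : ℝ) : ℂ))

/-! ### Sampled entries -/

/-- The multi-index `(a, α₂, …, α_{d-1}, c)`. -/
def fullIndex {n d : ℕ} (a : Fin n) (α : Fin (d - 2) → Fin n) (c : Fin n) : Fin d → Fin n :=
  fun i => if h0 : i.val = 0 then a else if h1 : i.val = d - 1 then c
    else α ⟨i.val - 1, by have := i.isLt; omega⟩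

/-- The positions of the entries of `T(:, α, Γ)`. -/
def block {n : ℕ} (d : ℕ) (α : Fin (d - 2) → Fin n) (Γ : Finset (Fin n)) :
    Finset (Fin d → Fin n) :=
  (Finset.univ ×ˢ Γ).image fun p : Fin n × Fin n => fullIndex p.1 α p.2

theorem fullIndex_mem_block {n d : ℕ} (a : Fin n) (α : Fin (d - 2) → Fin n)
    (Γ : Finset (Fin n)) (c : Γ) : fullIndex a α c.val ∈ block d α Γ :=
  Finset.mem_image.2
    ⟨(a, c.val), Finset.mem_product.2 ⟨Finset.mem_univ a, c.property⟩, rfl⟩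

/-- The choices that determine which entries the algorithm reads: two pairs of middle indices,
the constant middle index `γ = (m, …, m)`, and the sets of columns. The two slices of one
spectral probe share their set of columns. -/
structure Sampling (n d r : ℕ) where
  α : Fin (d - 2) → Fin n
  β : Fin (d - 2) → Fin n
  α' : Fin (d - 2) → Fin n
  β' : Fin (d - 2) → Fin n
  m : Fin n
  Γ : Finset (Fin n)
  Γ' : Finset (Fin n)
  Γγ : Finset (Fin n)
  card_Γ : Γ.card = r ^ 2
  card_Γ' : Γ'.card = r ^ 2
  card_Γγ : Γγ.card = r ^ 2
  ne : α ≠ β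
  ne' : α' ≠ β'
  pair_ne : ({α, β} : Set (Fin (d - 2) → Fin n)) ≠ {α', β'}

namespace Sampling

variable {n d r : ℕ}

/-- The set of observed positions. -/
def positions (s : Sampling n d r) : Finset (Fin d → Fin n) :=
  block d s.α s.Γ ∪ block d s.β s.Γ ∪ (block d s.α' s.Γ' ∪ block d s.β' s.Γ') ∪
    block d (fun _ => s.m) s.Γγ

/-- What the algorithm is given: the values at the observed positions, and nothing else. -/
abbrev Data (s : Sampling n d r) : Type := s.positions → ℂ

/-- The data of a tensor. -/
def observe (s : Sampling n d r) (T : (Fin d → Fin n) → ℂ) : s.Data := fun i => T i.val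

/-- The observed matrix `T(:, α, Γ)`. -/
def slice (s : Sampling n d r) (D : s.Data) (α : Fin (d - 2) → Fin n) (Γ : Finset (Fin n))
    (h : block d α Γ ⊆ s.positions) : Matrix (Fin n) Γ ℂ :=
  Matrix.of fun a c => D ⟨fullIndex a α c.val, h (fullIndex_mem_block a α Γ c)⟩

def sliceα (s : Sampling n d r) (D : s.Data) : Matrix (Fin n) s.Γ ℂ :=
  s.slice D s.α s.Γ fun i hi => by simp [positions, hi]

def sliceβ (s : Sampling n d r) (D : s.Data) : Matrix (Fin n) s.Γ ℂ :=
  s.slice D s.β s.Γ fun i hi => by simp [positions, hi]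

def sliceα' (s : Sampling n d r) (D : s.Data) : Matrix (Fin n) s.Γ' ℂ :=
  s.slice D s.α' s.Γ' fun i hi => by simp [positions, hi]

def sliceβ' (s : Sampling n d r) (D : s.Data) : Matrix (Fin n) s.Γ' ℂ :=
  s.slice D s.β' s.Γ' fun i hi => by simp [positions, hi]

def sliceγ (s : Sampling n d r) (D : s.Data) : Matrix (Fin n) s.Γγ ℂ :=
  s.slice D (fun _ => s.m) s.Γγ fun i hi => by simp [positions, hi]

end Sampling

/-! ### BLOSTR -/

/-- The block `F^{(j,k)}` of `F = E† E'`. -/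
noncomputable def probeBlock {n r : ℕ} (E E' : Matrix (Fin n) (Fin r × Fin r) ℂ) (j k : Fin r) :
    Matrix (Fin r) (Fin r) ℂ :=
  Matrix.of fun a b => (pinv E * E') (a, j) (b, k)

/-- The gauge matrices `K̂₁ = I` and `K̂_ℓ = F^{(1,1)} (F^{(ℓ,1)})⁻¹`. -/
noncomputable def gaugeBlock {n r : ℕ} [NeZero r] (E E' : Matrix (Fin n) (Fin r × Fin r) ℂ)
    (t : Fin r) : Matrix (Fin r) (Fin r) ℂ :=
  if t = 0 then 1 else probeBlock E E' 0 0 * (probeBlock E E' t 0)⁻¹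

/-- The first core, `Q̂_{1⟨1⟩} = E (Π(K̂))⁻¹`. Here `Π(K̂)` is the matrix whose entry at
`((j, t), (k, t'))` is `(K̂_t)_{jk}` if `t = t'`, and `0` otherwise. -/
noncomputable def firstCore {n r : ℕ} [NeZero r] (E E' : Matrix (Fin n) (Fin r × Fin r) ℂ) :
    Core n r :=
  foldAngle (E * (Matrix.blockDiagonal (gaugeBlock E E'))⁻¹)

/-- The core that follows `C`, given the matrix `N` of the cyclically shifted tensor and the
product `P` of the slices at `γ` of all the cores before `C`:
`N ((I ⊗ P) C_[1]ᵀ(:, Γ))†`, folded. -/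
noncomputable def nextCore {n r : ℕ} {Γ : Finset (Fin n)} (N : Matrix (Fin n) Γ ℂ)
    (P : Matrix (Fin r) (Fin r) ℂ) (C : Core n r) : Core n r :=
  foldAngle (N * pinv (((1 : Matrix (Fin r) (Fin r) ℂ) ⊗ₖ P) *
    (unfoldSquare C)ᵀ.submatrix id (fun c : Γ => c.val)))

/-- The loop over the cores, numbered from `0`: after `k` steps, the core number `k` and the
product of the slices at `γ` of the cores before it. Each step reads the observed matrix `N k`. -/
noncomputable def coreLoop {n r : ℕ} {Γ : Finset (Fin n)} (N : ℕ → Matrix (Fin n) Γ ℂ)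
    (γ : ℕ → Fin n) (C₀ : Core n r) : ℕ → Core n r × Matrix (Fin r) (Fin r) ℂ
  | 0 => (C₀, 1)
  | k + 1 =>
    (nextCore (N k) (coreLoop N γ C₀ k).2 (coreLoop N γ C₀ k).1,
      (coreLoop N γ C₀ k).2 * (coreLoop N γ C₀ k).1 (γ k))

namespace Sampling

variable {n d r : ℕ}

/-- The outcome of the two eigendecompositions, the spectral probes. -/
def IsProbe (s : Sampling n d r) (D : s.Data) (E E' : Matrix (Fin n) (Fin r × Fin r) ℂ) : Prop :=
  IsEigenbasis (s.sliceα D * pinv (s.sliceβ D)) E ∧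
    IsEigenbasis (s.sliceα' D * pinv (s.sliceβ' D)) E'

/-- The blocks that are inverted after the spectral probes are invertible. -/
def ProbeInvertible (E E' : Matrix (Fin n) (Fin r × Fin r) ℂ) [NeZero r] : Prop :=
  ∀ t : Fin r, t ≠ 0 → IsUnit (probeBlock E E' t 0)

/-- The cores `Q̂₁, …, Q̂_d` (numbered from `0`) that BLOSTR computes. A tensor with a single core
is invariant under cyclic shifts, so with `γ = (m, …, m)` the matrix that is read in each step of
the loop is `T(:, γ, Γ_γ)`. -/
noncomputable def cores [NeZero r] (s : Sampling n d r) (D : s.Data)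
    (E E' : Matrix (Fin n) (Fin r × Fin r) ℂ) (k : ℕ) : Core n r :=
  (coreLoop (fun _ => s.sliceγ D) (fun _ => s.m) (firstCore E E') k).1

/-! ### BLOSTR-S -/

/-- The product `Q̂₁^{(i₁)} ⋯ Q̂_d^{(i_d)}`. -/
noncomputable def coreProd [NeZero r] (s : Sampling n d r) (D : s.Data)
    (E E' : Matrix (Fin n) (Fin r × Fin r) ℂ) (i : Fin d → Fin n) : Matrix (Fin r) (Fin r) ℂ :=
  (List.ofFn fun k : Fin d => s.cores D E E' k.val (i k)).prod

/-- The candidate for the first slice, `Y diag(ω₁, …, ω_r) Y⁻¹`, where `ω_t` is the `d`-th root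
number `k t` of the eigenvalue `ev t`. -/
noncomputable def candidateHead (d : ℕ) {r : ℕ} (Y : Matrix (Fin r) (Fin r) ℂ) (ev : Fin r → ℂ)
    (k : Fin r → Fin d) : Matrix (Fin r) (Fin r) ℂ :=
  Y * Matrix.diagonal (fun t => dthRoot d (ev t) (k t).val) * Y⁻¹

/-- The candidate core `Q̄`: its first slice is `Q̄^{(1)} = candidateHead`, the others are
`(Q̄^{(1)})^{-(d-1)} Q̂₁^{(1)} ⋯ Q̂_{d-1}^{(1)} Q̂_d^{(j)}`. -/
noncomputable def candidate [NeZero n] [NeZero r] (s : Sampling n d r) (D : s.Data)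
    (E E' : Matrix (Fin n) (Fin r × Fin r) ℂ) (Y : Matrix (Fin r) (Fin r) ℂ) (ev : Fin r → ℂ)
    (k : Fin r → Fin d) : Core n r :=
  fun j => if j = 0 then candidateHead d Y ev k
    else (candidateHead d Y ev k ^ (d - 1))⁻¹ *
      s.coreProd D E E' (fun t => if t.val = d - 1 then j else 0)

/-- The test that ends the search: `Q̂₁^{(i₁)} ⋯ Q̂_d^{(i_d)} = Q̄^{(i₁)} ⋯ Q̄^{(i_d)}` for all
multi-indices. It reads no entry of the tensor. -/
def Accepts [NeZero r] (s : Sampling n d r) (D : s.Data)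
    (E E' : Matrix (Fin n) (Fin r × Fin r) ℂ) (C : Core n r) : Prop :=
  ∀ i : Fin d → Fin n, s.coreProd D E E' i = (List.ofFn fun t => C (i t)).prod

/-- A completed run of BLOSTR-S: one outcome of each of the choices that the algorithm leaves
open, such that every matrix it inverts is invertible and the search ends with success. -/
structure Run [NeZero n] [NeZero r] (s : Sampling n d r) (D : s.Data) where
  E : Matrix (Fin n) (Fin r × Fin r) ℂ
  E' : Matrix (Fin n) (Fin r × Fin r) ℂ
  probe : s.IsProbe D E E'
  probe_invertible : ProbeInvertible E E'
  Y : Matrix (Fin r) (Fin r) ℂ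
  ev : Fin r → ℂ
  eigen : IsEigendecomposition (s.coreProd D E E' fun _ => 0) Y ev
  k : Fin r → Fin d
  k_zero : (k 0).val = 0
  head_invertible : IsUnit (candidateHead d Y ev k)
  accepts : s.Accepts D E E' (s.candidate D E E' Y ev k)

/-- The core that a run returns. -/
noncomputable def Run.output [NeZero n] [NeZero r] {s : Sampling n d r} {D : s.Data}
    (R : s.Run D) : Core n r :=
  s.candidate D R.E R.E' R.Y R.ev R.k

/-- The algorithm cannot get stuck on the data `D`: each step can be carried out, whatever the
outcomes of the steps before it were, and the search over the roots meets a candidate that passes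
the test. -/
def Completes [NeZero n] [NeZero r] (s : Sampling n d r) (D : s.Data) : Prop :=
  (∃ E E', s.IsProbe D E E') ∧
    ∀ E E', s.IsProbe D E E' →
      ProbeInvertible E E' ∧
      (∃ Y ev, IsEigendecomposition (s.coreProd D E E' fun _ => 0) Y ev) ∧
      ∀ Y ev, IsEigendecomposition (s.coreProd D E E' fun _ => 0) Y ev →
        (∀ k : Fin r → Fin d, (k 0).val = 0 → IsUnit (candidateHead d Y ev k)) ∧
        ∃ k : Fin r → Fin d, (k 0).val = 0 ∧ s.Accepts D E E' (s.candidate D E E' Y ev k)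

/-! ### Choices of the middle indices -/

/-- The product `R^α` of the slices of a core along a middle index. -/
def midProd (Q : Core n r) (α : Fin (d - 2) → Fin n) : Matrix (Fin r) (Fin r) ℂ :=
  (List.ofFn fun k => Q (α k)).prod

/-- The choice of the middle indices is not degenerate for every core: for at least one core,
`R^α (R^β)⁻¹` and `R^{α'} (R^{β'})⁻¹` have simple spectra, and no entry of the change of basis
between their eigenbases is zero. For instance, `α = (1,1)`, `β = (2,1)`, `α' = (1,2)`,
`β' = (2,2)` is degenerate, since the two matrices are then equal for all cores. -/
def Nondegenerate (s : Sampling n d r) : Prop :=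
  ∃ (Q : Core n r) (U V : Matrix (Fin r) (Fin r) ℂ) (u v : Fin r → ℂ),
    IsUnit (midProd Q s.β) ∧ IsUnit (midProd Q s.β') ∧
    IsEigendecomposition (midProd Q s.α * (midProd Q s.β)⁻¹) U u ∧ Function.Injective u ∧
    IsEigendecomposition (midProd Q s.α' * (midProd Q s.β')⁻¹) V v ∧ Function.Injective v ∧
    ∀ i j, (U⁻¹ * V) i j ≠ 0

/-- Each of the two pairs differs in its first index only, and the two pairs of first indices
differ. For `d = 3` this holds for every choice. -/
def DiffersInFirst (s : Sampling n d r) : Prop :=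
  (∀ i : Fin (d - 2), i.val ≠ 0 → s.α i = s.β i ∧ s.α' i = s.β' i) ∧
    ∀ i : Fin (d - 2), i.val = 0 → ({s.α i, s.β i} : Set (Fin n)) ≠ {s.α' i, s.β' i}

end Sampling

end TensorRing

/-!
Write `A` for the unfolding `Q_⟨1⟩`. Since `T(:, α, Γ) = A (1 ⊗ R^α) B` with the same matrix `B`
for all `α`, a spectral probe is `T(:, α, Γ) T(:, β, Γ)† = A (1 ⊗ R^α (R^β)⁻¹) A†`, whose
eigenbases are the matrices `A (1 ⊗ U) diag(K₁, …, K_r)` with `U` an eigenbasis of `R^α (R^β)⁻¹`.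
For two probes the blocks of `E† E'` are `(U⁻¹ V)_{jk} K_j⁻¹ K'_k`, so that their quotients give
every `K_t` up to a scalar and the common left factor `K₁`. Correcting `E` by them leaves a gauge
transform of `Q` as the first core, and each step of the loop carries this gauge over to the next
core, so that the product of the computed cores is the product of the slices of `Q` up to a
conjugation.

If two cores have the same `d`-fold products, up to a conjugation, and their first slices are
invertible, then comparing products that differ in one factor yields the gauge. The search for the
`d`-th root succeeds at `c Q⁽¹⁾`, up to conjugation, with `c` the root of unity for which the
eigenvalue of index `1` is the root with `k₁ = 0`.

All conditions on `Q` used here say that a polynomial in its entries (a determinant, a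
discriminant) does not vanish. If such a polynomial is nonzero at one core, it has finitely many
zeros on every line through that core, hence it is nonzero almost everywhere by polar coordinates.
-/

namespace TensorRing

/-! ### Generic points -/

/-- Fubini in polar form: for almost every radius `t`, the function `v ↦ f (p + t v)` vanishes
almost nowhere, and for `t ≠ 0` homotheties preserve null sets. -/
theorem ae_ne_zero_of_countable_on_lines {E : Type*} [NormedAddCommGroup E] [NormedSpace ℝ E]
    [FiniteDimensional ℝ E] [MeasurableSpace E] [BorelSpace E] (μ : Measure E)
    [μ.IsAddHaarMeasure] {f : E → ℂ} (hf : Continuous f) (p : E)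
    (h : ∀ v : E, {t : ℝ | f (p + t • v) = 0}.Countable) : ∀ᵐ x ∂μ, f x ≠ 0 := by
  have hmeas : MeasurableSet {x : E × ℝ | f (p + x.2 • x.1) ≠ 0} :=
    (isOpen_ne_fun (by fun_prop) continuous_const).measurableSet
  have hlines : ∀ᵐ v ∂μ, ∀ᵐ t : ℝ, f (p + t • v) ≠ 0 :=
    Filter.Eventually.of_forall fun v => by simpa [ae_iff] using (h v).measure_zero volume
  rw [Measure.ae_ae_comm (p := fun v t => f (p + t • v) ≠ 0) hmeas] at hlines
  have hne : ∀ᵐ t : ℝ, t ≠ 0 := by simp [ae_iff]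
  obtain ⟨t, ht, ht0⟩ := (hlines.and hne).exists
  have hscaled : μ ((t • ·) ⁻¹' {v | f (p + v) = 0}) = 0 := by simpa [ae_iff] using ht
  rw [Measure.addHaar_preimage_smul μ ht0] at hscaled
  have htranslated : μ ((p + ·) ⁻¹' {x | f x = 0}) = 0 :=
    (mul_eq_zero.1 hscaled).resolve_left (by simp [ht0])
  rw [measure_preimage_add] at htranslated
  simpa [ae_iff] using htranslated

theorem exists_eval_eq_eval_line {R σ : Type*} [CommSemiring R] (P : MvPolynomial σ R)
    (a b : σ → R) : ∃ g : Polynomial R, ∀ t, g.eval t = P.eval fun i => a i + t * b i := by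
  refine ⟨MvPolynomial.aeval
    (fun i => Polynomial.C (a i) + Polynomial.C (b i) * Polynomial.X) P, fun t => ?_⟩
  rw [← Polynomial.coe_aeval_eq_eval, MvPolynomial.comp_aeval_apply]
  simp [MvPolynomial.aeval_eq_eval, mul_comm t]

theorem ae_eval_ne_zero {E σ : Type*} [NormedAddCommGroup E] [NormedSpace ℝ E]
    [FiniteDimensional ℝ E] [MeasurableSpace E] [BorelSpace E] (μ : Measure E)
    [μ.IsAddHaarMeasure] (φ : E →ₗ[ℝ] σ → ℂ) {P : MvPolynomial σ ℂ} {p : E}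
    (hp : P.eval (φ p) ≠ 0) : ∀ᵐ x ∂μ, P.eval (φ x) ≠ 0 := by
  refine ae_ne_zero_of_countable_on_lines μ
    ((MvPolynomial.continuous_eval P).comp φ.continuous_of_finiteDimensional) p fun v => ?_
  obtain ⟨g, hg⟩ := exists_eval_eq_eval_line P (φ p) (φ v)
  have hline (t : ℝ) : P.eval (φ (p + t • v)) = g.eval (t : ℂ) := by
    rw [hg, map_add, map_smul]
    rfl
  have hg0 : g ≠ 0 := by
    rintro rfl
    exact hp (by simpa using hline 0)
  simp only [hline]
  exact ((Polynomial.finite_setOfPred_isRoot hg0).preimage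
    Complex.ofReal_injective.injOn).countable

/-- The generic core, whose entries are independent variables: polynomial conditions on a core
are polynomials in these variables. -/
noncomputable def genericCore (n r : ℕ) (a : Fin n) :
    Matrix (Fin r) (Fin r) (MvPolynomial (Fin n × Fin r × Fin r) ℂ) :=
  Matrix.of fun j k => MvPolynomial.X (a, j, k)

/-- Specialization of the generic core to `Q`. -/
noncomputable def evalCore {n r : ℕ} (Q : Core n r) :
    MvPolynomial (Fin n × Fin r × Fin r) ℂ →+* ℂ :=
  MvPolynomial.eval fun p => Q p.1 p.2.1 p.2.2

theorem map_genericCore {n r : ℕ} (Q : Core n r) (a : Fin n) :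
    (genericCore n r a).map (evalCore Q) = Q a := by
  ext j k
  simp [genericCore, evalCore]

theorem ae_evalCore_ne_zero {n r : ℕ} {P : MvPolynomial (Fin n × Fin r × Fin r) ℂ}
    {Q : Core n r} (hQ : evalCore Q P ≠ 0) :
    ∀ᵐ x : Fin n → Fin r → Fin r → ℂ, evalCore (toCore x) P ≠ 0 :=
  have : (volume : Measure (Fin r → Fin r → ℂ)).IsAddHaarMeasure := Measure.pi.isAddHaarMeasure _
  have : (volume : Measure (Fin n → Fin r → Fin r → ℂ)).IsAddHaarMeasure :=
    Measure.pi.isAddHaarMeasure _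
  let entries : (Fin n → Fin r → Fin r → ℂ) →ₗ[ℝ] Fin n × Fin r × Fin r → ℂ :=
    { toFun := fun x p => x p.1 p.2.1 p.2.2
      map_add' := fun _ _ => rfl
      map_smul' := fun _ _ => rfl }
  ae_eval_ne_zero volume entries (p := Q) hQ

/-! ### Moore-Penrose inverses of matrices of full column rank -/

section MoorePenrose

variable {l m p : Type*} [Fintype l] [Fintype m] [Fintype p]

theorem IsMoorePenrose.pinv_eq {A : Matrix l m ℂ} {B : Matrix m l ℂ} (h : IsMoorePenrose A B) :
    pinv A = B := by
  have hex : ∃ B, IsMoorePenrose A B := ⟨B, h⟩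
  rw [pinv, dif_pos hex]
  exact hex.choose_spec.unique h

theorem linearIndependent_col_of_mul_eq_one {m : Type*} [Finite m] [DecidableEq m]
    {A : Matrix l m ℂ} {B : Matrix m l ℂ} (h : B * A = 1) : LinearIndependent ℂ A.col := by
  have := Fintype.ofFinite m
  refine Matrix.mulVec_injective_iff.1 (Function.LeftInverse.injective (g := B.mulVec) fun v => ?_)
  rw [Matrix.mulVec_mulVec, h, Matrix.one_mulVec]

open ComplexOrder in
theorem isUnit_conjTranspose_mul_self [DecidableEq m] {A : Matrix l m ℂ}
    (hA : LinearIndependent ℂ A.col) : IsUnit (Aᴴ * A) :=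
  (Matrix.PosDef.conjTranspose_mul_self A (Matrix.mulVec_injective_iff.2 hA)).isUnit

theorem isMoorePenrose_of_linearIndependent_col [DecidableEq m] {A : Matrix l m ℂ}
    (hA : LinearIndependent ℂ A.col) : IsMoorePenrose A ((Aᴴ * A)⁻¹ * Aᴴ) := by
  have hleft : (Aᴴ * A)⁻¹ * Aᴴ * A = 1 := by
    rw [Matrix.mul_assoc, Matrix.nonsing_inv_mul _
      ((Matrix.isUnit_iff_isUnit_det _).1 (isUnit_conjTranspose_mul_self hA))]
  refine ⟨?_, ?_, ?_, ?_⟩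
  · rw [Matrix.mul_assoc, hleft, Matrix.mul_one]
  · rw [hleft, Matrix.one_mul]
  · simp only [Matrix.conjTranspose_mul, Matrix.conjTranspose_nonsing_inv,
      Matrix.conjTranspose_conjTranspose, Matrix.mul_assoc]
  · rw [hleft, Matrix.conjTranspose_one]

theorem isMoorePenrose_pinv {A : Matrix l m ℂ} (hA : LinearIndependent ℂ A.col) :
    IsMoorePenrose A (pinv A) := by
  classical
  have h := isMoorePenrose_of_linearIndependent_col hA
  rwa [h.pinv_eq]

theorem pinv_mul_self [DecidableEq m] {A : Matrix l m ℂ} (hA : LinearIndependent ℂ A.col) :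
    pinv A * A = 1 := by
  rw [(isMoorePenrose_of_linearIndependent_col hA).pinv_eq, Matrix.mul_assoc,
    Matrix.nonsing_inv_mul _
      ((Matrix.isUnit_iff_isUnit_det _).1 (isUnit_conjTranspose_mul_self hA))]

theorem mul_pinv_self_of_card_eq [DecidableEq p] {C : Matrix p m ℂ}
    (hC : LinearIndependent ℂ C.col) (hcard : Fintype.card p = Fintype.card m) :
    C * pinv C = 1 := by
  classical
  exact (Matrix.mul_eq_one_comm_of_card_eq (R := ℂ) (eq := hcard)).2 (pinv_mul_self hC)

theorem pinv_mul {A : Matrix l p ℂ} {C : Matrix p m ℂ} (hA : LinearIndependent ℂ A.col)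
    (hC : LinearIndependent ℂ C.col) (hcard : Fintype.card p = Fintype.card m) :
    pinv (A * C) = pinv C * pinv A := by
  classical
  have hCC := mul_pinv_self_of_card_eq hC hcard
  have hA' := isMoorePenrose_pinv hA
  have hl : A * C * (pinv C * pinv A) = A * pinv A := by
    rw [Matrix.mul_assoc, ← Matrix.mul_assoc C, hCC, Matrix.one_mul]
  have hr : pinv C * pinv A * (A * C) = 1 := by
    rw [Matrix.mul_assoc, ← Matrix.mul_assoc _ A, pinv_mul_self hA, Matrix.one_mul,
      pinv_mul_self hC]
  refine IsMoorePenrose.pinv_eq ⟨?_, ?_, ?_, ?_⟩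
  · rw [Matrix.mul_assoc, hr, Matrix.mul_one]
  · rw [hr, Matrix.one_mul]
  · rw [hl, hA'.hermLeft]
  · rw [hr, Matrix.conjTranspose_one]

theorem pinv_eq_inv [DecidableEq m] {A : Matrix m m ℂ} (hA : IsUnit A) : pinv A = A⁻¹ :=
  (Matrix.inv_eq_left_inv (pinv_mul_self (Matrix.linearIndependent_cols_iff_isUnit.2 hA))).symm

theorem linearIndependent_col_mul {l m p : Type*} [Finite m] [Fintype p]
    {A : Matrix l p ℂ} {C : Matrix p m ℂ}
    (hA : LinearIndependent ℂ A.col) (hC : LinearIndependent ℂ C.col) :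
    LinearIndependent ℂ (A * C).col := by
  have := Fintype.ofFinite m
  rw [← Matrix.mulVec_injective_iff] at hA hC ⊢
  have hcomp : (A * C).mulVec = A.mulVec ∘ C.mulVec := by
    ext1 v
    rw [Function.comp_apply, Matrix.mulVec_mulVec]
  rw [hcomp]
  exact hA.comp hC

theorem pinv_mul_of_isUnit_left [DecidableEq p] {C : Matrix p m ℂ} (hC : LinearIndependent ℂ C.col)
    (hcard : Fintype.card p = Fintype.card m) {Y : Matrix p p ℂ} (hY : IsUnit Y) :
    pinv (Y * C) = pinv C * Y⁻¹ := by
  rw [pinv_mul (Matrix.linearIndependent_cols_iff_isUnit.2 hY) hC hcard, pinv_eq_inv hY]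

theorem mul_mul_pinv_mul_mul [DecidableEq p] {A : Matrix l p ℂ} {C : Matrix p m ℂ}
    (hA : LinearIndependent ℂ A.col) (hC : LinearIndependent ℂ C.col)
    (hcard : Fintype.card p = Fintype.card m) (X : Matrix p p ℂ) {Y : Matrix p p ℂ}
    (hY : IsUnit Y) : A * (X * C) * pinv (A * (Y * C)) = A * (X * Y⁻¹) * pinv A := by
  have hYC := linearIndependent_col_mul (Matrix.linearIndependent_cols_iff_isUnit.2 hY) hC
  rw [pinv_mul hA hYC hcard, pinv_mul_of_isUnit_left hC hcard hY]
  calc A * (X * C) * (pinv C * Y⁻¹ * pinv A)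
      = A * (X * (C * pinv C) * Y⁻¹) * pinv A := by simp only [Matrix.mul_assoc]
    _ = A * (X * Y⁻¹) * pinv A := by rw [mul_pinv_self_of_card_eq hC hcard, Matrix.mul_one]

end MoorePenrose

/-! ### Simple spectra -/

section Spectrum

variable {ι R S K : Type*} [Fintype ι] [DecidableEq ι] [CommRing R] [CommRing S] [Field K]

/-- The resultant of the characteristic polynomial and its derivative: up to sign the discriminant
`Matrix.discr`. The formal degrees are fixed in order that it commutes with ring homomorphisms. -/
noncomputable def charpolyDiscr (M : Matrix ι ι R) : R :=
  M.charpoly.resultant M.charpoly.derivative (Fintype.card ι) (Fintype.card ι - 1)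

theorem map_charpolyDiscr (f : R →+* S) (M : Matrix ι ι R) :
    f (charpolyDiscr M) = charpolyDiscr (M.map f) := by
  rw [charpolyDiscr, charpolyDiscr, Matrix.charpoly_map, Polynomial.derivative_map,
    Polynomial.resultant_map_map]

theorem charpolyDiscr_ne_zero_iff [CharZero K] (M : Matrix ι ι K) :
    charpolyDiscr M ≠ 0 ↔ M.charpoly.Separable := by
  have hdeg := M.charpoly_natDegree_eq_dim
  rw [charpolyDiscr, ← hdeg, ← Polynomial.natDegree_derivative, Ne,
    Polynomial.resultant_eq_zero_iff, Polynomial.separable_def]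
  simp [M.charpoly_monic.ne_zero]

theorem mul_eq_mul_diagonal_iff {l m : Type*} [Fintype l] [Fintype m] [DecidableEq m]
    {M : Matrix l l R} {U : Matrix l m R} {ev : m → R} :
    M * U = U * Matrix.diagonal ev ↔ ∀ t, M *ᵥ U.col t = ev t • U.col t := by
  simp only [← Matrix.ext_iff, funext_iff, Matrix.mul_diagonal]
  rw [forall_comm]
  simp [Matrix.mul_apply, Matrix.mulVec, dotProduct, mul_comm]

theorem isUnit_of_mul_eq_mul_diagonal {M U : Matrix ι ι K} {ev : ι → K}
    (hev : Function.Injective ev) (hU : ∀ t, U.col t ≠ 0)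
    (h : M * U = U * Matrix.diagonal ev) : IsUnit U := by
  rw [← Matrix.linearIndependent_cols_iff_isUnit]
  refine Module.End.eigenvectors_linearIndependent' (Matrix.toLin' M) ev hev U.col fun t => ?_
  exact ⟨Module.End.mem_eigenspace_iff.2 (mul_eq_mul_diagonal_iff.1 h t), hU t⟩

theorem eq_diagonal_of_commute {M : Matrix ι ι K} {ev : ι → K} (hev : Function.Injective ev)
    (h : Commute M (Matrix.diagonal ev)) : M = Matrix.diagonal fun t => M t t := by
  ext i j
  rcases eq_or_ne i j with rfl | hij
  · simp
  · have hentry := congrFun₂ h.eq i j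
    rw [Matrix.mul_diagonal, Matrix.diagonal_mul, mul_comm] at hentry
    rw [Matrix.diagonal_apply_ne _ hij]
    exact (mul_eq_mul_right_iff.1 hentry).resolve_left fun hji => hij (hev hji).symm

theorem exists_mulVec_eq_smul_of_isRoot_charpoly {M : Matrix ι ι K} {z : K}
    (hz : M.charpoly.IsRoot z) : ∃ v ≠ 0, M *ᵥ v = z • v := by
  have hspec := Matrix.mem_spectrum_of_isRoot_charpoly hz
  rw [← Matrix.spectrum_toLin', ← Module.End.hasEigenvalue_iff_mem_spectrum] at hspec
  obtain ⟨v, hv⟩ := hspec.exists_hasEigenvector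
  exact ⟨v, hv.2, by simpa using hv.apply_eq_smul⟩

theorem exists_injective_isRoot_charpoly [IsAlgClosed K] {M : Matrix ι ι K}
    (hM : M.charpoly.Separable) :
    ∃ ev : ι → K, Function.Injective ev ∧ ∀ t, M.charpoly.IsRoot (ev t) := by
  classical
  have hcard : Fintype.card ι = Fintype.card {z // z ∈ M.charpoly.roots.toFinset} := by
    rw [Fintype.card_coe, Multiset.toFinset_card_of_nodup (Polynomial.nodup_roots hM),
      ← (IsAlgClosed.splits M.charpoly).natDegree_eq_card_roots, Matrix.charpoly_natDegree_eq_dim]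
  let e := Fintype.equivOfCardEq hcard
  exact ⟨fun t => (e t).val, Subtype.val_injective.comp e.injective, fun t =>
    Polynomial.isRoot_of_mem_roots (Multiset.mem_toFinset.1 (e t).property)⟩

end Spectrum

section Eigendecomposition

variable {r : ℕ} {H Y : Matrix (Fin r) (Fin r) ℂ} {ev : Fin r → ℂ}

theorem isEigendecomposition_of_mul_eq (hY : IsUnit Y) (h : H * Y = Y * Matrix.diagonal ev) :
    IsEigendecomposition H Y ev := by
  refine ⟨hY, ?_⟩
  rw [← h, Matrix.mul_nonsing_inv_cancel_right _ _ ((Matrix.isUnit_iff_isUnit_det _).1 hY)]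

theorem exists_isEigendecomposition (hH : H.charpoly.Separable) :
    ∃ (Y : Matrix (Fin r) (Fin r) ℂ) (ev : Fin r → ℂ),
      IsEigendecomposition H Y ev ∧ Function.Injective ev := by
  obtain ⟨ev, hev, hroot⟩ := exists_injective_isRoot_charpoly hH
  choose v hv hHv using fun t => exists_mulVec_eq_smul_of_isRoot_charpoly (hroot t)
  let Y : Matrix (Fin r) (Fin r) ℂ := (Matrix.of v)ᵀ
  have hHY : H * Y = Y * Matrix.diagonal ev := mul_eq_mul_diagonal_iff.2 hHv
  exact ⟨Y, ev, isEigendecomposition_of_mul_eq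
    (isUnit_of_mul_eq_mul_diagonal hev hv hHY) hHY, hev⟩

namespace IsEigendecomposition

theorem mul_eq (h : IsEigendecomposition H Y ev) : H * Y = Y * Matrix.diagonal ev := by
  rw [h.2, Matrix.nonsing_inv_mul_cancel_right _ _ ((Matrix.isUnit_iff_isUnit_det _).1 h.1)]

theorem separable_charpoly_iff (h : IsEigendecomposition H Y ev) :
    H.charpoly.Separable ↔ Function.Injective ev := by
  obtain ⟨⟨Y, rfl⟩, rfl⟩ := h
  rw [Matrix.charpoly_units_conj, Matrix.charpoly_diagonal,
    Polynomial.separable_prod_X_sub_C_iff]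

theorem isUnit_iff (h : IsEigendecomposition H Y ev) : IsUnit H ↔ ∀ t, ev t ≠ 0 := by
  rw [h.2, Matrix.isUnit_iff_isUnit_det, Matrix.det_conj h.1, Matrix.det_diagonal,
    isUnit_iff_ne_zero, Finset.prod_ne_zero_iff]
  simp

theorem pow (h : IsEigendecomposition H Y ev) (k : ℕ) :
    IsEigendecomposition (H ^ k) Y (ev ^ k) := by
  refine ⟨h.1, ?_⟩
  obtain ⟨⟨Y, rfl⟩, rfl⟩ := h
  rw [← Matrix.coe_units_inv, Units.conj_pow, Matrix.diagonal_pow]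

theorem smul (h : IsEigendecomposition H Y ev) (c : ℂ) :
    IsEigendecomposition (c • H) Y (c • ev) := by
  refine ⟨h.1, ?_⟩
  rw [h.2, Matrix.diagonal_smul, Matrix.mul_smul, Matrix.smul_mul]

theorem eigenvalues_unique {ev' : Fin r → ℂ} (h : IsEigendecomposition H Y ev)
    (h' : IsEigendecomposition H Y ev') : ev = ev' :=
  Matrix.diagonal_injective (h.1.mul_left_cancel (h.mul_eq.symm.trans h'.mul_eq))

theorem exists_of_commute (h : IsEigendecomposition H Y ev) (hev : Function.Injective ev)
    {M : Matrix (Fin r) (Fin r) ℂ} (hM : Commute M H) :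
    ∃ ω : Fin r → ℂ, IsEigendecomposition M Y ω := by
  have hY := (Matrix.isUnit_iff_isUnit_det _).1 h.1
  have hcomm : Commute (Y⁻¹ * M * Y) (Matrix.diagonal ev) := by
    calc Y⁻¹ * M * Y * Matrix.diagonal ev = Y⁻¹ * (M * H) * Y := by
          simp only [Matrix.mul_assoc, h.mul_eq]
      _ = Y⁻¹ * (H * Y) * (Y⁻¹ * M * Y) := by
          rw [hM.eq]
          simp only [Matrix.mul_assoc, Matrix.mul_nonsing_inv_cancel_left _ _ hY]
      _ = Matrix.diagonal ev * (Y⁻¹ * M * Y) := by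
          rw [h.mul_eq, Matrix.nonsing_inv_mul_cancel_left _ _ hY]
  refine ⟨fun t => (Y⁻¹ * M * Y) t t, isEigendecomposition_of_mul_eq h.1 ?_⟩
  rw [← eq_diagonal_of_commute hev hcomm, Matrix.mul_assoc,
    Matrix.mul_nonsing_inv_cancel_left _ _ hY]

end IsEigendecomposition

end Eigendecomposition

/-! ### General position of two eigenbases -/

section GeneralPosition

variable {R S : Type*} [CommRing R] [CommRing S] {r : ℕ}

/-- The columns of this matrix are the `r²` matrices `M ^ a * M' ^ b`, written as vectors. -/
def krylovMatrix (M M' : Matrix (Fin r) (Fin r) R) :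
    Matrix (Fin r × Fin r) (Fin r × Fin r) R :=
  Matrix.of fun p q => (M ^ q.1.val * M' ^ q.2.val) p.1 p.2

theorem map_krylovMatrix (f : R →+* S) (M M' : Matrix (Fin r) (Fin r) R) :
    (krylovMatrix M M').map f = krylovMatrix (M.map f) (M'.map f) := by
  ext p q
  simp only [krylovMatrix, Matrix.map_apply, Matrix.of_apply, ← RingHom.mapMatrix_apply,
    ← map_pow, ← map_mul]
  rfl

variable {M M' U V : Matrix (Fin r) (Fin r) ℂ} {u v : Fin r → ℂ}

theorem krylovMatrix_eq (hU : IsEigendecomposition M U u) (hV : IsEigendecomposition M' V v) :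
    krylovMatrix M M' = (U ⊗ₖ (V⁻¹)ᵀ) * Matrix.diagonal (fun p => (U⁻¹ * V) p.1 p.2) *
      (Matrix.vandermonde u ⊗ₖ Matrix.vandermonde v) := by
  ext ⟨i, j⟩ ⟨a, b⟩
  have hab : M ^ a.val * M' ^ b.val =
      U * (Matrix.diagonal (u ^ a.val) * (U⁻¹ * V) * Matrix.diagonal (v ^ b.val)) * V⁻¹ := by
    rw [(hU.pow a).2, (hV.pow b).2]
    simp only [Matrix.mul_assoc]
  rw [krylovMatrix, Matrix.of_apply, hab, Matrix.mul_apply, Matrix.mul_apply,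
    Fintype.sum_prod_type, Finset.sum_comm]
  refine Finset.sum_congr rfl fun l _ => ?_
  rw [Matrix.mul_apply, Finset.sum_mul]
  refine Finset.sum_congr rfl fun k _ => ?_
  simp only [Matrix.mul_diagonal, Matrix.diagonal_mul, Matrix.kronecker_apply,
    Matrix.transpose_apply, Matrix.vandermonde_apply, Pi.pow_apply]
  ring

theorem det_krylovMatrix_ne_zero_iff (hU : IsEigendecomposition M U u)
    (hV : IsEigendecomposition M' V v) (hu : Function.Injective u) (hv : Function.Injective v) :
    (krylovMatrix M M').det ≠ 0 ↔ ∀ i j, (U⁻¹ * V) i j ≠ 0 := by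
  have hU0 : U.det ≠ 0 := ((Matrix.isUnit_iff_isUnit_det _).1 hU.1).ne_zero
  have hV0 : V.det ≠ 0 := ((Matrix.isUnit_iff_isUnit_det _).1 hV.1).ne_zero
  rw [krylovMatrix_eq hU hV, Matrix.det_mul, Matrix.det_mul, Matrix.det_diagonal,
    Matrix.det_kronecker, Matrix.det_kronecker, Matrix.det_transpose]
  simp [hU0, hV0, Matrix.det_vandermonde_ne_zero_iff.2 hu, Matrix.det_vandermonde_ne_zero_iff.2 hv,
    Finset.prod_eq_zero_iff]

/-- Two matrices with simple spectra, such that no entry of the change of basis between their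
eigenbases vanishes. -/
def InGeneralPosition (M M' : Matrix (Fin r) (Fin r) ℂ) : Prop :=
  ∃ (U V : Matrix (Fin r) (Fin r) ℂ) (u v : Fin r → ℂ),
    IsEigendecomposition M U u ∧ Function.Injective u ∧
    IsEigendecomposition M' V v ∧ Function.Injective v ∧ ∀ i j, (U⁻¹ * V) i j ≠ 0

/-- A polynomial in the entries of two matrices that detects general position. -/
noncomputable def generalPositionDet (M M' : Matrix (Fin r) (Fin r) R) : R :=
  charpolyDiscr M * charpolyDiscr M' * (krylovMatrix M M').det

theorem map_generalPositionDet (f : R →+* S) (M M' : Matrix (Fin r) (Fin r) R) :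
    f (generalPositionDet M M') = generalPositionDet (M.map f) (M'.map f) := by
  rw [generalPositionDet, generalPositionDet, map_mul, map_mul, map_charpolyDiscr,
    map_charpolyDiscr, RingHom.map_det, RingHom.mapMatrix_apply, map_krylovMatrix]

theorem generalPositionDet_ne_zero_iff :
    generalPositionDet M M' ≠ 0 ↔ InGeneralPosition M M' := by
  rw [generalPositionDet, mul_ne_zero_iff, mul_ne_zero_iff, charpolyDiscr_ne_zero_iff,
    charpolyDiscr_ne_zero_iff]
  constructor
  · rintro ⟨⟨hM, hM'⟩, hdet⟩
    obtain ⟨U, u, hU, hu⟩ := exists_isEigendecomposition hM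
    obtain ⟨V, v, hV, hv⟩ := exists_isEigendecomposition hM'
    exact ⟨U, V, u, v, hU, hu, hV, hv, (det_krylovMatrix_ne_zero_iff hU hV hu hv).1 hdet⟩
  · rintro ⟨U, V, u, v, hU, hu, hV, hv, hUV⟩
    exact ⟨⟨hU.separable_charpoly_iff.2 hu, hV.separable_charpoly_iff.2 hv⟩,
      (det_krylovMatrix_ne_zero_iff hU hV hu hv).2 hUV⟩

theorem InGeneralPosition.inv_mul_apply_ne_zero (h : InGeneralPosition M M')
    (hU : IsEigendecomposition M U u) (hu : Function.Injective u)
    (hV : IsEigendecomposition M' V v) (hv : Function.Injective v) (i j : Fin r) :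
    (U⁻¹ * V) i j ≠ 0 := by
  rw [← generalPositionDet_ne_zero_iff, generalPositionDet] at h
  exact (det_krylovMatrix_ne_zero_iff hU hV hu hv).1 (right_ne_zero_of_mul h) i j

theorem InGeneralPosition.smul (h : InGeneralPosition M M') {c c' : ℂ} (hc : c ≠ 0)
    (hc' : c' ≠ 0) : InGeneralPosition (c • M) (c' • M') := by
  obtain ⟨U, V, u, v, hU, hu, hV, hv, hUV⟩ := h
  exact ⟨U, V, c • u, c' • v, hU.smul c, (smul_right_injective ℂ hc).comp hu, hV.smul c',
    (smul_right_injective ℂ hc').comp hv, hUV⟩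

theorem inGeneralPosition_mul_adjugate_iff {A B A' B' : Matrix (Fin r) (Fin r) ℂ}
    (hB : IsUnit B) (hB' : IsUnit B') :
    InGeneralPosition (A * B.adjugate) (A' * B'.adjugate) ↔
      InGeneralPosition (A * B⁻¹) (A' * B'⁻¹) := by
  have hadj {C : Matrix (Fin r) (Fin r) ℂ} (hC : IsUnit C) :
      C.det ≠ 0 ∧ C.adjugate = C.det • C⁻¹ := by
    have hdet := (Matrix.isUnit_iff_isUnit_det _).1 hC
    refine ⟨hdet.ne_zero, ?_⟩
    rw [Matrix.inv_def, Ring.inverse_eq_inv', smul_smul, mul_inv_cancel₀ hdet.ne_zero, one_smul]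
  obtain ⟨hB0, hBadj⟩ := hadj hB
  obtain ⟨hB0', hBadj'⟩ := hadj hB'
  rw [hBadj, hBadj', Matrix.mul_smul, Matrix.mul_smul]
  refine ⟨fun h => ?_, fun h => h.smul hB0 hB0'⟩
  simpa [smul_smul, hB0, hB0'] using h.smul (inv_ne_zero hB0) (inv_ne_zero hB0')

end GeneralPosition

/-! ### Complex roots -/

theorem dthRoot_eq {d : ℕ} (hd : d ≠ 0) (z : ℂ) (k : ℕ) :
    dthRoot d z k = dthRoot d z 0 * Complex.exp (2 * Real.pi * Complex.I / d) ^ k := by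
  have hd' : (d : ℂ) ≠ 0 := Nat.cast_ne_zero.2 hd
  rw [dthRoot, dthRoot, ← Complex.exp_nat_mul, mul_assoc (_ : ℂ) (Complex.exp _),
    ← Complex.exp_add]
  congr 2
  push_cast
  field_simp
  ring

theorem norm_mul_exp_angle (z : ℂ) : (‖z‖ : ℂ) * Complex.exp (Complex.I * angle z) = z := by
  rw [angle]
  split_ifs
  · rw [mul_comm Complex.I, Complex.norm_mul_exp_arg_mul_I]
  · push_cast
    rw [mul_add, Complex.exp_add, mul_comm Complex.I (z.arg : ℂ),
      mul_comm Complex.I (2 * (Real.pi : ℂ)), Complex.exp_two_pi_mul_I, mul_one,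
      Complex.norm_mul_exp_arg_mul_I]

theorem dthRoot_zero_pow {d : ℕ} (hd : d ≠ 0) (z : ℂ) : dthRoot d z 0 ^ d = z := by
  have hd' : (d : ℂ) ≠ 0 := Nat.cast_ne_zero.2 hd
  rw [dthRoot, mul_pow, ← Complex.exp_nat_mul, ← Complex.ofReal_pow, one_div,
    Real.rpow_inv_natCast_pow (norm_nonneg z) hd]
  convert norm_mul_exp_angle z using 3
  push_cast
  field_simp
  ring

theorem dthRoot_pow {d : ℕ} (hd : d ≠ 0) (z : ℂ) (k : ℕ) : dthRoot d z k ^ d = z := by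
  rw [dthRoot_eq hd, mul_pow, dthRoot_zero_pow hd, ← pow_mul, mul_comm k d, pow_mul,
    (Complex.isPrimitiveRoot_exp d hd).pow_eq_one, one_pow, mul_one]

theorem exists_dthRoot_eq {d : ℕ} (hd : d ≠ 0) {z w : ℂ} (hz : z ≠ 0) (hw : w ^ d = z) :
    ∃ k : Fin d, dthRoot d z k.val = w := by
  have : NeZero d := ⟨hd⟩
  have hroot := dthRoot_zero_pow hd z
  obtain ⟨k, hk, hk'⟩ := (Complex.isPrimitiveRoot_exp d hd).eq_pow_of_pow_eq_one
    (ξ := w / dthRoot d z 0) (by rw [div_pow, hw, hroot, div_self hz])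
  refine ⟨⟨k, hk⟩, ?_⟩
  rw [dthRoot_eq hd, hk', mul_div_cancel₀]
  intro h0
  rw [h0, zero_pow hd] at hroot
  exact hz hroot.symm

/-! ### Unfoldings -/

section Unfoldings

variable {n r : ℕ}

/-- The columns of `Q_[1]ᵀ` in `Γ`. -/
def squareCols (Q : Core n r) (Γ : Finset (Fin n)) : Matrix (Fin r × Fin r) Γ ℂ :=
  (unfoldSquare Q)ᵀ.submatrix id (fun c : Γ => c.val)

theorem unfoldAngle_mul_kronecker (Q : Core n r) (K M : Matrix (Fin r) (Fin r) ℂ) :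
    unfoldAngle Q * (K ⊗ₖ M) = unfoldAngle fun a => Kᵀ * Q a * M := by
  ext a ⟨j, k⟩
  simp only [unfoldAngle, Matrix.mul_apply, Matrix.of_apply, Fintype.sum_prod_type,
    Matrix.kronecker_apply, Matrix.transpose_apply, Finset.sum_mul]
  rw [Finset.sum_comm]
  exact Finset.sum_congr rfl fun _ _ => Finset.sum_congr rfl fun _ _ => by ring

theorem kronecker_mul_squareCols (Q : Core n r) (Γ : Finset (Fin n))
    (K M : Matrix (Fin r) (Fin r) ℂ) :
    (K ⊗ₖ M) * squareCols Q Γ = squareCols (fun a => M * Q a * Kᵀ) Γ := by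
  ext ⟨j, k⟩ c
  simp only [squareCols, unfoldSquare, Matrix.mul_apply, Matrix.of_apply, Fintype.sum_prod_type,
    Matrix.kronecker_apply, Matrix.transpose_apply, Finset.sum_mul, Matrix.submatrix_apply, id]
  exact Finset.sum_congr rfl fun _ _ => Finset.sum_congr rfl fun _ _ => by ring

theorem symTensor_fullIndex {d : ℕ} (hd : 2 ≤ d) (Q : Core n r) (a c : Fin n)
    (α : Fin (d - 2) → Fin n) :
    symTensor d Q (fullIndex a α c) = (Q a * Sampling.midProd Q α * Q c).trace := by
  obtain ⟨e, rfl⟩ : ∃ e, d = e + 2 := ⟨d - 2, by omega⟩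
  rw [symTensor, List.ofFn_succ, List.ofFn_succ', List.prod_cons, List.concat_eq_append,
    List.prod_append, List.prod_singleton, ← Matrix.mul_assoc, Sampling.midProd]
  congr 3
  · congr 2
    ext1 k
    have hk : k.val ≠ e := k.isLt.ne
    simp [fullIndex, hk]
  · simp [fullIndex]

theorem trace_mul_mul_eq_unfoldAngle_mul (Q : Core n r) (R : Matrix (Fin r) (Fin r) ℂ)
    (Γ : Finset (Fin n)) (a : Fin n) (c : Γ) :
    (Q a * R * Q c.val).trace =
      (unfoldAngle Q * ((1 : Matrix (Fin r) (Fin r) ℂ) ⊗ₖ R * squareCols Q Γ)) a c := by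
  rw [kronecker_mul_squareCols, Matrix.mul_assoc, Matrix.trace, Matrix.mul_apply,
    Fintype.sum_prod_type]
  refine Finset.sum_congr rfl fun i _ => ?_
  rw [Matrix.diag_apply, Matrix.mul_apply]
  refine Finset.sum_congr rfl fun j _ => ?_
  simp [unfoldAngle, squareCols, unfoldSquare]

theorem Sampling.slice_observe {d : ℕ} (hd : 2 ≤ d) (Q : Core n r) (s : Sampling n d r)
    (α : Fin (d - 2) → Fin n) (Γ : Finset (Fin n)) (h : block d α Γ ⊆ s.positions) :
    s.slice (s.observe (symTensor d Q)) α Γ h =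
      unfoldAngle Q * ((1 : Matrix (Fin r) (Fin r) ℂ) ⊗ₖ midProd Q α * squareCols Q Γ) := by
  ext a c
  rw [← trace_mul_mul_eq_unfoldAngle_mul, ← symTensor_fullIndex hd]
  rfl

/-- The genericity of a core on which BLOSTR-S relies: its slices are invertible, and any `r²` of
them are linearly independent. -/
structure IsRegular (Q : Core n r) : Prop where
  isUnit : ∀ a, IsUnit (Q a)
  linearIndependent : ∀ Γ : Finset (Fin n), Γ.card = r ^ 2 →
    LinearIndependent ℂ (squareCols Q Γ).col

theorem card_prod_eq_card_coe {Γ : Finset (Fin n)} (hΓ : Γ.card = r ^ 2) :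
    Fintype.card (Fin r × Fin r) = Fintype.card Γ := by
  rw [Fintype.card_prod, Fintype.card_fin, Fintype.card_coe, hΓ, sq]

theorem linearIndependent_unfoldAngle_col {Q : Core n r} {Γ : Finset (Fin n)}
    (hΓ : Γ.card = r ^ 2) (hQ : LinearIndependent ℂ (squareCols Q Γ).col) :
    LinearIndependent ℂ (unfoldAngle Q).col := by
  have hinv : (pinv (squareCols Q Γ))ᵀ * (squareCols Q Γ)ᵀ = 1 := by
    rw [← Matrix.transpose_mul, mul_pinv_self_of_card_eq hQ (card_prod_eq_card_coe hΓ),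
      Matrix.transpose_one]
  refine LinearIndependent.of_comp (LinearMap.funLeft ℂ ℂ (Subtype.val : Γ → Fin n)) ?_
  exact (linearIndependent_col_of_mul_eq_one hinv).comp Prod.swap Prod.swap_injective

theorem isUnit_prod_ofFn {M : Type*} [Monoid M] {l : ℕ} {f : Fin l → M}
    (hf : ∀ k, IsUnit (f k)) : IsUnit (List.ofFn f).prod := by
  refine List.prod_isUnit fun x hx => ?_
  obtain ⟨k, rfl⟩ := List.mem_ofFn.1 hx
  exact hf k

end Unfoldings

/-! ### Spectral probes -/

section BlockDiagonal

theorem diagonal_snd_eq_kronecker {ι κ R : Type*} [DecidableEq ι] [DecidableEq κ]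
    [NonAssocSemiring R] (ev : κ → R) :
    Matrix.diagonal (fun p : ι × κ => ev p.2) = (1 : Matrix ι ι R) ⊗ₖ Matrix.diagonal ev := by
  rw [← Matrix.diagonal_one, Matrix.diagonal_kronecker_diagonal]
  simp only [one_mul]

variable {ι κ R : Type*} [Fintype ι] [DecidableEq ι] [Fintype κ] [DecidableEq κ] [Field R]
  {K : κ → Matrix ι ι R}

theorem inv_one_kronecker (U : Matrix κ κ R) :
    ((1 : Matrix ι ι R) ⊗ₖ U)⁻¹ = (1 : Matrix ι ι R) ⊗ₖ U⁻¹ := by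
  rw [Matrix.inv_kronecker, inv_one]

theorem isUnit_blockDiagonal_iff : IsUnit (Matrix.blockDiagonal K) ↔ ∀ t, IsUnit (K t) := by
  simp only [Matrix.isUnit_iff_isUnit_det, Matrix.det_blockDiagonal, isUnit_iff_ne_zero,
    Finset.prod_ne_zero_iff, Finset.mem_univ, forall_const]

theorem inv_blockDiagonal (hK : ∀ t, IsUnit (K t)) :
    (Matrix.blockDiagonal K)⁻¹ = Matrix.blockDiagonal fun t => (K t)⁻¹ := by
  refine Matrix.inv_eq_left_inv ?_
  rw [← Matrix.blockDiagonal_mul, ← Matrix.blockDiagonal_one]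
  exact congrArg _ (funext fun t =>
    Matrix.nonsing_inv_mul _ ((Matrix.isUnit_iff_isUnit_det _).1 (hK t)))

theorem blockDiagonal_mul_one_kronecker_apply (K : κ → Matrix ι ι R) (W : Matrix κ κ R)
    (a c : ι) (j k : κ) :
    (Matrix.blockDiagonal K * (1 : Matrix ι ι R) ⊗ₖ W) (a, j) (c, k) = W j k * K j a c := by
  rw [Matrix.mul_apply, Finset.sum_eq_single (c, j)]
  · simp [mul_comm]
  · rintro ⟨x, y⟩ - hxy
    rw [Matrix.blockDiagonal_apply', Matrix.kronecker_apply, Matrix.one_apply]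
    split_ifs with h1 h2
    · exact absurd (by rw [h1, h2]) hxy
    all_goals simp
  · simp

theorem eq_blockDiagonal_of_commute {ev : κ → R} {Z : Matrix (ι × κ) (ι × κ) R}
    (hev : Function.Injective ev) (h : Commute Z (Matrix.diagonal fun p => ev p.2)) :
    Z = Matrix.blockDiagonal fun t => Matrix.of fun j k => Z (j, t) (k, t) := by
  ext ⟨j, t⟩ ⟨k, t'⟩
  rw [Matrix.blockDiagonal_apply']
  split_ifs with htt
  · rw [htt, Matrix.of_apply]
  · have hent := congrFun (congrFun h.eq (j, t)) (k, t')
    rw [Matrix.mul_diagonal, Matrix.diagonal_mul, mul_comm] at hent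
    exact (mul_eq_mul_right_iff.1 hent).resolve_left fun heq => htt (hev heq.symm)

end BlockDiagonal

section Probes

variable {n r : ℕ} {S U V : Matrix (Fin r) (Fin r) ℂ} {ev : Fin r → ℂ}
  {K K' : Fin r → Matrix (Fin r) (Fin r) ℂ}

theorem exists_isEigendecomposition_of_one_kronecker_mul
    {X : Matrix (Fin r × Fin r) (Fin r × Fin r) ℂ} (hX : IsUnit X) (hev : Function.Injective ev)
    (h : (1 : Matrix (Fin r) (Fin r) ℂ) ⊗ₖ S * X =
      X * Matrix.diagonal fun p : Fin r × Fin r => ev p.2) :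
    ∃ U, IsEigendecomposition S U ev := by
  have hcol : ∀ t, ∃ j, (fun k => X (j, k) (t, t)) ≠ 0 := by
    intro t
    by_contra! hzero
    exact (Matrix.linearIndependent_cols_iff_isUnit.2 hX).ne_zero (t, t)
      (funext fun p => congrFun (hzero p.1) p.2)
  choose j hj using hcol
  have hSU : S * Matrix.of (fun k t => X (j t, k) (t, t)) =
      Matrix.of (fun k t => X (j t, k) (t, t)) * Matrix.diagonal ev := by
    ext k t
    have hent := congrFun (congrFun h (j t, k)) (t, t)
    rw [Matrix.mul_diagonal, Matrix.mul_apply, Fintype.sum_prod_type] at hent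
    rw [Matrix.mul_diagonal, Matrix.mul_apply, Matrix.of_apply, ← hent]
    simp [Matrix.one_apply]
  exact ⟨_, isEigendecomposition_of_mul_eq (isUnit_of_mul_eq_mul_diagonal hev hj hSU) hSU⟩

theorem exists_eq_one_kronecker_mul_blockDiagonal
    {X : Matrix (Fin r × Fin r) (Fin r × Fin r) ℂ} (hX : IsUnit X) (hev : Function.Injective ev)
    (hU : IsEigendecomposition S U ev)
    (h : (1 : Matrix (Fin r) (Fin r) ℂ) ⊗ₖ S * X =
      X * Matrix.diagonal fun p : Fin r × Fin r => ev p.2) :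
    ∃ K : Fin r → Matrix (Fin r) (Fin r) ℂ, (∀ t, IsUnit (K t)) ∧
      X = (1 : Matrix (Fin r) (Fin r) ℂ) ⊗ₖ U * Matrix.blockDiagonal K := by
  have hU1 : IsUnit ((1 : Matrix (Fin r) (Fin r) ℂ) ⊗ₖ U) := isUnit_one.kronecker hU.1
  have hUdet := (Matrix.isUnit_iff_isUnit_det _).1 hU1
  set Z := ((1 : Matrix (Fin r) (Fin r) ℂ) ⊗ₖ U)⁻¹ * X with hZ
  have hXZ : (1 : Matrix (Fin r) (Fin r) ℂ) ⊗ₖ U * Z = X :=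
    Matrix.mul_nonsing_inv_cancel_left _ _ hUdet
  have hcomm : Commute Z (Matrix.diagonal fun p : Fin r × Fin r => ev p.2) := by
    have hSU : (1 : Matrix (Fin r) (Fin r) ℂ) ⊗ₖ S * (1 : Matrix (Fin r) (Fin r) ℂ) ⊗ₖ U =
        (1 : Matrix (Fin r) (Fin r) ℂ) ⊗ₖ U *
          Matrix.diagonal fun p : Fin r × Fin r => ev p.2 := by
      rw [diagonal_snd_eq_kronecker, ← Matrix.mul_kronecker_mul, ← Matrix.mul_kronecker_mul,
        hU.mul_eq]
    rw [Commute, SemiconjBy, hZ, Matrix.mul_assoc, ← h, ← hXZ, ← Matrix.mul_assoc _ _ Z, hSU,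
      Matrix.mul_assoc, Matrix.nonsing_inv_mul_cancel_left _ _ hUdet,
      Matrix.nonsing_inv_mul_cancel_left _ _ hUdet]
  have hZK := eq_blockDiagonal_of_commute hev hcomm
  have hZunit : IsUnit Z := (Matrix.isUnit_nonsing_inv_iff.2 hU1).mul hX
  rw [hZK, isUnit_blockDiagonal_iff] at hZunit
  exact ⟨_, hZunit, by rw [← hZK, hXZ]⟩

theorem mul_pinv_mul_eq_of_mul_eq_mul_diagonal {l p q : Type*} [Fintype l] [Fintype p] [Fintype q]
    [DecidableEq q] {A : Matrix l p ℂ} (hA : LinearIndependent ℂ A.col)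
    {T : Matrix p p ℂ} {E : Matrix l q ℂ} {w : q → ℂ} (hw : ∀ i, w i ≠ 0)
    (h : A * T * pinv A * E = E * Matrix.diagonal w) : A * (pinv A * E) = E := by
  classical
  have hE : E = A * (T * pinv A * E * (Matrix.diagonal w)⁻¹) := by
    have hdet : IsUnit (Matrix.diagonal w).det := by
      rw [Matrix.det_diagonal, isUnit_iff_ne_zero]
      exact Finset.prod_ne_zero_iff.2 fun i _ => hw i
    calc E = E * Matrix.diagonal w * (Matrix.diagonal w)⁻¹ :=
          (Matrix.mul_nonsing_inv_cancel_right _ E hdet).symm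
      _ = _ := by rw [← h]; simp only [Matrix.mul_assoc]
  rw [hE, ← Matrix.mul_assoc (pinv A), pinv_mul_self hA, Matrix.one_mul]

/-- The general eigenbasis of `A (1 ⊗ S) A†`, where the columns of `U` are eigenvectors of `S` and
`K t` is a change of basis in the eigenspace of the `t`-th eigenvalue. -/
def probeBasis (A : Matrix (Fin n) (Fin r × Fin r) ℂ) (U : Matrix (Fin r) (Fin r) ℂ)
    (K : Fin r → Matrix (Fin r) (Fin r) ℂ) : Matrix (Fin n) (Fin r × Fin r) ℂ :=
  A * ((1 : Matrix (Fin r) (Fin r) ℂ) ⊗ₖ U * Matrix.blockDiagonal K)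

variable {A E : Matrix (Fin n) (Fin r × Fin r) ℂ}

-- In `IsEigenbasis`, the product `E * diagonal _` is elaborated as the multiplication of
-- `CStarMatrix`, which the lemmas on `Matrix` do not match syntactically.
theorem isEigenbasis_iff {M : Matrix (Fin n) (Fin n) ℂ} :
    IsEigenbasis M E ↔ ∃ ev : Fin r → ℂ, Function.Injective ev ∧ (∀ t, ev t ≠ 0) ∧
      LinearIndependent ℂ E.col ∧
      M * E = E * Matrix.diagonal fun p : Fin r × Fin r => ev p.2 :=
  Iff.rfl

theorem IsEigenbasis.exists_eq_probeBasis (hA : LinearIndependent ℂ A.col)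
    (h : IsEigenbasis (A * (1 : Matrix (Fin r) (Fin r) ℂ) ⊗ₖ S * pinv A) E) :
    ∃ (U : Matrix (Fin r) (Fin r) ℂ) (ev : Fin r → ℂ) (K : Fin r → Matrix (Fin r) (Fin r) ℂ),
      IsEigendecomposition S U ev ∧ Function.Injective ev ∧ (∀ t, IsUnit (K t)) ∧
        E = probeBasis A U K := by
  obtain ⟨ev, hev, hne, hlin, hE⟩ := isEigenbasis_iff.1 h
  have hAE := mul_pinv_mul_eq_of_mul_eq_mul_diagonal hA (fun p : Fin r × Fin r => hne p.2) hE
  have hX : IsUnit (pinv A * E) := by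
    rw [← Matrix.mulVec_injective_iff_isUnit]
    rw [← hAE, ← Matrix.mulVec_injective_iff] at hlin
    intro v w hvw
    refine hlin ?_
    rw [← Matrix.mulVec_mulVec, hvw, Matrix.mulVec_mulVec]
  have heig : (1 : Matrix (Fin r) (Fin r) ℂ) ⊗ₖ S * (pinv A * E) =
      pinv A * E * Matrix.diagonal fun p : Fin r × Fin r => ev p.2 := by
    rw [Matrix.mul_assoc (pinv A), ← hE, Matrix.mul_assoc, Matrix.mul_assoc,
      ← Matrix.mul_assoc (pinv A) A, pinv_mul_self hA, Matrix.one_mul]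
  obtain ⟨U, hU⟩ := exists_isEigendecomposition_of_one_kronecker_mul hX hev heig
  obtain ⟨K, hK, hXK⟩ := exists_eq_one_kronecker_mul_blockDiagonal hX hev hU heig
  exact ⟨U, ev, K, hU, hev, hK, by rw [probeBasis, ← hXK, hAE]⟩

theorem IsEigendecomposition.isEigenbasis (hA : LinearIndependent ℂ A.col)
    (hU : IsEigendecomposition S U ev) (hev : Function.Injective ev) (hne : ∀ t, ev t ≠ 0) :
    IsEigenbasis (A * (1 : Matrix (Fin r) (Fin r) ℂ) ⊗ₖ S * pinv A)
      (A * (1 : Matrix (Fin r) (Fin r) ℂ) ⊗ₖ U) := by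
  refine isEigenbasis_iff.2 ⟨ev, hev, hne, linearIndependent_col_mul hA
    (Matrix.linearIndependent_cols_iff_isUnit.2 (isUnit_one.kronecker hU.1)), ?_⟩
  rw [Matrix.mul_assoc, ← Matrix.mul_assoc (pinv A), pinv_mul_self hA, Matrix.one_mul,
    Matrix.mul_assoc, Matrix.mul_assoc, ← Matrix.mul_kronecker_mul, hU.mul_eq,
    Matrix.mul_kronecker_mul, ← diagonal_snd_eq_kronecker]

theorem pinv_probeBasis_mul_probeBasis (hA : LinearIndependent ℂ A.col) (hU : IsUnit U)
    (hK : ∀ t, IsUnit (K t)) :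
    pinv (probeBasis A U K) * probeBasis A V K' =
      Matrix.blockDiagonal (fun t => (K t)⁻¹) *
        (1 : Matrix (Fin r) (Fin r) ℂ) ⊗ₖ (U⁻¹ * V) * Matrix.blockDiagonal K' := by
  have hC := (isUnit_one.kronecker hU).mul (isUnit_blockDiagonal_iff.2 hK)
  rw [probeBasis, probeBasis, pinv_mul hA (Matrix.linearIndependent_cols_iff_isUnit.2 hC) rfl,
    pinv_eq_inv hC, Matrix.mul_inv_rev, inv_blockDiagonal hK, inv_one_kronecker, Matrix.mul_assoc,
    ← Matrix.mul_assoc (pinv A), pinv_mul_self hA, Matrix.one_mul,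
    ← Matrix.one_mul (1 : Matrix (Fin r) (Fin r) ℂ), Matrix.mul_kronecker_mul]
  simp only [Matrix.one_mul, Matrix.mul_assoc]

theorem probeBlock_probeBasis (hA : LinearIndependent ℂ A.col) (hU : IsUnit U)
    (hK : ∀ t, IsUnit (K t)) (j k : Fin r) :
    probeBlock (probeBasis A U K) (probeBasis A V K') j k =
      (U⁻¹ * V) j k • ((K j)⁻¹ * K' k) := by
  ext a b
  rw [probeBlock, Matrix.of_apply, pinv_probeBasis_mul_probeBasis hA hU hK, Matrix.smul_apply,
    Matrix.mul_apply, Matrix.mul_apply (M := (K j)⁻¹), Fintype.sum_prod_type, smul_eq_mul,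
    Finset.mul_sum]
  refine Finset.sum_congr rfl fun c _ => ?_
  simp only [blockDiagonal_mul_one_kronecker_apply, Matrix.blockDiagonal_apply', mul_ite, mul_zero,
    Finset.sum_ite_eq', Finset.mem_univ, if_true]
  ring

theorem isUnit_probeBlock_probeBasis_iff [NeZero r] (hA : LinearIndependent ℂ A.col)
    (hU : IsUnit U) (hK : ∀ t, IsUnit (K t)) (hK' : ∀ t, IsUnit (K' t)) (j k : Fin r) :
    IsUnit (probeBlock (probeBasis A U K) (probeBasis A V K') j k) ↔ (U⁻¹ * V) j k ≠ 0 := by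
  rw [probeBlock_probeBasis hA hU hK]
  refine ⟨?_, fun h =>
    ((Matrix.isUnit_nonsing_inv_iff.2 (hK j)).mul (hK' k)).smul (Units.mk0 _ h)⟩
  intro h h0
  rw [h0, zero_smul] at h
  exact not_isUnit_zero h

variable [NeZero r]

theorem gaugeBlock_probeBasis (hA : LinearIndependent ℂ A.col) (hU : IsUnit U)
    (hK : ∀ t, IsUnit (K t)) (hK' : ∀ t, IsUnit (K' t)) (hW : ∀ t, (U⁻¹ * V) t 0 ≠ 0)
    (t : Fin r) :
    gaugeBlock (probeBasis A U K) (probeBasis A V K') t =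
      ((U⁻¹ * V) 0 0 / (U⁻¹ * V) t 0) • ((K 0)⁻¹ * K t) := by
  have hdet := fun t => (Matrix.isUnit_iff_isUnit_det _).1 (hK t)
  rw [gaugeBlock]
  split_ifs with ht
  · rw [ht, div_self (hW 0), one_smul, Matrix.nonsing_inv_mul _ (hdet 0)]
  · have hF := (Matrix.isUnit_iff_isUnit_det _).1
      ((isUnit_probeBlock_probeBasis_iff hA hU hK hK' t 0).2 (hW t))
    have hquot : probeBlock (probeBasis A U K) (probeBasis A V K') 0 0 =
        ((U⁻¹ * V) 0 0 / (U⁻¹ * V) t 0) • ((K 0)⁻¹ * K t) *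
          probeBlock (probeBasis A U K) (probeBasis A V K') t 0 := by
      rw [probeBlock_probeBasis hA hU hK, probeBlock_probeBasis hA hU hK, Matrix.smul_mul,
        Matrix.mul_smul, smul_smul, div_mul_cancel₀ _ (hW t), Matrix.mul_assoc,
        Matrix.mul_nonsing_inv_cancel_left _ _ (hdet t)]
    rw [hquot, Matrix.mul_nonsing_inv_cancel_right _ _ hF]

theorem isUnit_gaugeBlock_probeBasis (hA : LinearIndependent ℂ A.col) (hU : IsUnit U)
    (hK : ∀ t, IsUnit (K t)) (hK' : ∀ t, IsUnit (K' t)) (hW : ∀ t, (U⁻¹ * V) t 0 ≠ 0)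
    (t : Fin r) : IsUnit (gaugeBlock (probeBasis A U K) (probeBasis A V K') t) := by
  rw [gaugeBlock_probeBasis hA hU hK hK' hW]
  exact ((Matrix.isUnit_nonsing_inv_iff.2 (hK 0)).mul (hK t)).smul
    (Units.mk0 _ (div_ne_zero (hW 0) (hW t)))

theorem kronecker_mul_blockDiagonal_gaugeBlock (hA : LinearIndependent ℂ A.col) (hU : IsUnit U)
    (hK : ∀ t, IsUnit (K t)) (hK' : ∀ t, IsUnit (K' t)) (hW : ∀ t, (U⁻¹ * V) t 0 ≠ 0) :
    K 0 ⊗ₖ Matrix.diagonal (fun t => (U⁻¹ * V) t 0 / (U⁻¹ * V) 0 0) *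
        Matrix.blockDiagonal (gaugeBlock (probeBasis A U K) (probeBasis A V K')) =
      Matrix.blockDiagonal K := by
  rw [Matrix.kronecker_diagonal, ← Matrix.blockDiagonal_mul]
  refine congrArg _ (funext fun t => ?_)
  rw [gaugeBlock_probeBasis hA hU hK hK' hW, op_smul_eq_smul, Matrix.smul_mul, Matrix.mul_smul,
    smul_smul, div_mul_div_cancel₀ (hW 0), div_self (hW t), one_smul,
    Matrix.mul_nonsing_inv_cancel_left _ _ ((Matrix.isUnit_iff_isUnit_det _).1 (hK 0))]

theorem firstCore_probeBasis {Q : Core n r} (hQ : LinearIndependent ℂ (unfoldAngle Q).col)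
    (hU : IsUnit U) (hK : ∀ t, IsUnit (K t)) (hK' : ∀ t, IsUnit (K' t))
    (hW : ∀ t, (U⁻¹ * V) t 0 ≠ 0) (a : Fin n) :
    firstCore (probeBasis (unfoldAngle Q) U K) (probeBasis (unfoldAngle Q) V K') a =
      (K 0)ᵀ * Q a *
        (U * Matrix.diagonal fun t => (U⁻¹ * V) t 0 / (U⁻¹ * V) 0 0) := by
  have hg := (Matrix.isUnit_iff_isUnit_det _).1
    (isUnit_blockDiagonal_iff.2 (isUnit_gaugeBlock_probeBasis hQ hU hK hK' hW))
  have hfirst : probeBasis (unfoldAngle Q) U K * (Matrix.blockDiagonal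
        (gaugeBlock (probeBasis (unfoldAngle Q) U K) (probeBasis (unfoldAngle Q) V K')))⁻¹ =
      unfoldAngle fun a => (K 0)ᵀ * Q a *
        (U * Matrix.diagonal fun t => (U⁻¹ * V) t 0 / (U⁻¹ * V) 0 0) := by
    conv_lhs =>
      enter [1]
      rw [probeBasis, ← kronecker_mul_blockDiagonal_gaugeBlock hQ hU hK hK' hW]
    rw [← Matrix.mul_assoc, ← Matrix.mul_assoc, Matrix.mul_nonsing_inv_cancel_right _ _ hg,
      Matrix.mul_assoc, ← Matrix.mul_kronecker_mul, Matrix.one_mul, unfoldAngle_mul_kronecker]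
  rw [firstCore, hfirst]
  rfl

-- All the gauge blocks but the first one vanish, so the inverse in the definition of the first
-- core has the junk value `0`.
theorem firstCore_eq_zero {E E' : Matrix (Fin n) (Fin r × Fin r) ℂ} (hr : 2 ≤ r)
    (h : probeBlock E E' 0 0 = 0) : firstCore E E' = 0 := by
  have hsingular : ¬ IsUnit (Matrix.blockDiagonal (gaugeBlock E E')) := by
    have h10 : (⟨1, hr⟩ : Fin r) ≠ 0 := by simp [Fin.ext_iff]
    intro hunit
    have h1 := isUnit_blockDiagonal_iff.1 hunit ⟨1, hr⟩
    rw [gaugeBlock, if_neg h10, h, Matrix.zero_mul] at h1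
    exact not_isUnit_zero h1
  rw [Matrix.isUnit_iff_isUnit_det] at hsingular
  rw [firstCore, Matrix.nonsing_inv_apply_not_isUnit _ hsingular, Matrix.mul_zero]
  rfl

end Probes

/-! ### The loop over the cores -/

section Loop

variable {n r e : ℕ} {Q : Core n r} {Γ : Finset (Fin n)} {Z G₀ G₁ : Matrix (Fin r) (Fin r) ℂ}

theorem nextCore_eq (hΓ : Γ.card = r ^ 2) (hQ : LinearIndependent ℂ (squareCols Q Γ).col)
    {C : Core n r} {P X H : Matrix (Fin r) (Fin r) ℂ} (hX : IsUnit X) (hH : IsUnit H)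
    (hC : ∀ a, P * C a = X * Q a * H) (Y : Matrix (Fin r) (Fin r) ℂ) (a : Fin n) :
    nextCore (unfoldAngle Q * ((1 : Matrix (Fin r) (Fin r) ℂ) ⊗ₖ Y * squareCols Q Γ)) P C a =
      H⁻¹ * Q a * (Y * X⁻¹) := by
  have hcols : (1 : Matrix (Fin r) (Fin r) ℂ) ⊗ₖ P * squareCols C Γ =
      Hᵀ ⊗ₖ X * squareCols Q Γ := by
    rw [kronecker_mul_squareCols, kronecker_mul_squareCols]
    simp only [hC, Matrix.transpose_one, Matrix.mul_one, Matrix.transpose_transpose]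
  have hpinv : pinv (Hᵀ ⊗ₖ X * squareCols Q Γ) = pinv (squareCols Q Γ) * Hᵀ⁻¹ ⊗ₖ X⁻¹ := by
    rw [pinv_mul_of_isUnit_left hQ (card_prod_eq_card_coe hΓ)
      (((Matrix.isUnit_transpose _).2 hH).kronecker hX), Matrix.inv_kronecker]
  have hnext : unfoldAngle Q * ((1 : Matrix (Fin r) (Fin r) ℂ) ⊗ₖ Y * squareCols Q Γ) *
      (pinv (squareCols Q Γ) * Hᵀ⁻¹ ⊗ₖ X⁻¹) =
        unfoldAngle fun a => H⁻¹ * Q a * (Y * X⁻¹) := by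
    rw [Matrix.mul_assoc, Matrix.mul_assoc, ← Matrix.mul_assoc (squareCols Q Γ),
      mul_pinv_self_of_card_eq hQ (card_prod_eq_card_coe hΓ), Matrix.one_mul,
      ← Matrix.mul_kronecker_mul, Matrix.one_mul, unfoldAngle_mul_kronecker,
      Matrix.transpose_nonsing_inv, Matrix.transpose_transpose]
  rw [← hpinv, ← hcols] at hnext
  exact congrArg (fun M => foldAngle M a) hnext

/-- The gauge matrices of the computed cores: those of the first core are given, and the loop
determines the others from the slice `Z` and the number `e` of the slices of the middle index. -/
noncomputable def gaugeSeq (e : ℕ) (Z G₀ G₁ : Matrix (Fin r) (Fin r) ℂ) :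
    ℕ → Matrix (Fin r) (Fin r) ℂ
  | 0 => G₀
  | 1 => G₁
  | k + 2 => Z ^ e * Z⁻¹ ^ k * G₀

theorem isUnit_gaugeSeq (hZ : IsUnit Z) (h₀ : IsUnit G₀) (h₁ : IsUnit G₁) :
    ∀ k, IsUnit (gaugeSeq e Z G₀ G₁ k)
  | 0 => h₀
  | 1 => h₁
  | k + 2 => ((hZ.pow e).mul ((Matrix.isUnit_nonsing_inv_iff.2 hZ).pow k)).mul h₀

theorem gaugeSeq_add_two (hZ : IsUnit Z) : gaugeSeq e Z G₀ G₁ (e + 2) = G₀ := by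
  rw [gaugeSeq, Matrix.inv_pow', Matrix.mul_nonsing_inv _
    ((Matrix.isUnit_iff_isUnit_det _).1 (hZ.pow e)), Matrix.one_mul]

theorem coreLoop_eq (hΓ : Γ.card = r ^ 2) (hQ : LinearIndependent ℂ (squareCols Q Γ).col)
    {m : Fin n} (hm : IsUnit (Q m)) (h₀ : IsUnit G₀) (h₁ : IsUnit G₁) {C₀ : Core n r}
    (hC₀ : ∀ a, C₀ a = G₀⁻¹ * Q a * G₁) {N : Matrix (Fin n) Γ ℂ}
    (hN : N = unfoldAngle Q *
      ((1 : Matrix (Fin r) (Fin r) ℂ) ⊗ₖ (Q m ^ e) * squareCols Q Γ)) (k : ℕ) :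
    (∀ a, (coreLoop (fun _ => N) (fun _ => m) C₀ k).1 a =
      (gaugeSeq e (Q m) G₀ G₁ k)⁻¹ * Q a * gaugeSeq e (Q m) G₀ G₁ (k + 1)) ∧
    (coreLoop (fun _ => N) (fun _ => m) C₀ k).2 = G₀⁻¹ * Q m ^ k * gaugeSeq e (Q m) G₀ G₁ k := by
  have hG := isUnit_gaugeSeq (e := e) hm h₀ h₁
  have hdet₀ := (Matrix.isUnit_iff_isUnit_det _).1 h₀
  induction k with
  | zero =>
    refine ⟨hC₀, ?_⟩
    rw [pow_zero, Matrix.mul_one]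
    exact (Matrix.nonsing_inv_mul _ hdet₀).symm
  | succ k ih =>
    have hprod : ∀ a, (coreLoop (fun _ => N) (fun _ => m) C₀ k).2 *
        (coreLoop (fun _ => N) (fun _ => m) C₀ k).1 a =
          G₀⁻¹ * Q m ^ k * Q a * gaugeSeq e (Q m) G₀ G₁ (k + 1) := by
      intro a
      rw [ih.1, ih.2]
      simp only [Matrix.mul_assoc]
      rw [Matrix.mul_nonsing_inv_cancel_left _ _ ((Matrix.isUnit_iff_isUnit_det _).1 (hG k))]
    refine ⟨fun a => ?_, ?_⟩
    · have hnext := nextCore_eq hΓ hQ ((Matrix.isUnit_nonsing_inv_iff.2 h₀).mul (hm.pow k))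
        (hG (k + 1)) hprod (Q m ^ e) a
      rw [← hN, Matrix.mul_inv_rev, Matrix.nonsing_inv_nonsing_inv _ hdet₀, ← Matrix.inv_pow',
        ← Matrix.mul_assoc (Q m ^ e)] at hnext
      exact hnext
    · rw [pow_succ, ← Matrix.mul_assoc]
      exact hprod m

theorem prod_ofFn_gauge {ι R : Type*} [Fintype ι] [DecidableEq ι] [CommRing R]
    {G : ℕ → Matrix ι ι R} (hG : ∀ k, IsUnit (G k)) {d : ℕ} (f : Fin d → Matrix ι ι R) :
    (List.ofFn fun k : Fin d => (G k.val)⁻¹ * f k * G (k.val + 1)).prod =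
      (G 0)⁻¹ * (List.ofFn f).prod * G d := by
  have hdet := fun k => (Matrix.isUnit_iff_isUnit_det _).1 (hG k)
  induction d with
  | zero => rw [List.ofFn_zero, List.ofFn_zero, List.prod_nil, Matrix.mul_one,
      Matrix.nonsing_inv_mul _ (hdet 0)]
  | succ d ih =>
    simp only [List.ofFn_succ', List.concat_eq_append, List.prod_append, List.prod_singleton,
      Fin.val_castSucc, Fin.val_last, ih fun k => f k.castSucc]
    simp only [Matrix.mul_assoc]
    rw [Matrix.mul_nonsing_inv_cancel_left _ _ (hdet d)]

end Loop

namespace Sampling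

variable {n d r : ℕ} {Q : Core n r} {s : Sampling n d r}
  {E E' : Matrix (Fin n) (Fin r × Fin r) ℂ}

theorem isUnit_midProd (hQ : ∀ a, IsUnit (Q a)) (α : Fin (d - 2) → Fin n) :
    IsUnit (midProd Q α) :=
  isUnit_prod_ofFn fun _ => hQ _

theorem isProbe_iff (hd : 2 ≤ d) (hQ : IsRegular Q) :
    s.IsProbe (s.observe (symTensor d Q)) E E' ↔
      IsEigenbasis (unfoldAngle Q * (1 : Matrix (Fin r) (Fin r) ℂ) ⊗ₖ
        (midProd Q s.α * (midProd Q s.β)⁻¹) * pinv (unfoldAngle Q)) E ∧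
      IsEigenbasis (unfoldAngle Q * (1 : Matrix (Fin r) (Fin r) ℂ) ⊗ₖ
        (midProd Q s.α' * (midProd Q s.β')⁻¹) * pinv (unfoldAngle Q)) E' := by
  have hquot : ∀ {Γ : Finset (Fin n)} (_ : Γ.card = r ^ 2) (α β : Fin (d - 2) → Fin n),
      unfoldAngle Q * ((1 : Matrix (Fin r) (Fin r) ℂ) ⊗ₖ midProd Q α * squareCols Q Γ) *
        pinv (unfoldAngle Q * ((1 : Matrix (Fin r) (Fin r) ℂ) ⊗ₖ midProd Q β * squareCols Q Γ)) =
      unfoldAngle Q * (1 : Matrix (Fin r) (Fin r) ℂ) ⊗ₖ (midProd Q α * (midProd Q β)⁻¹) *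
        pinv (unfoldAngle Q) := by
    intro Γ hΓ α β
    have hcols := hQ.linearIndependent Γ hΓ
    rw [mul_mul_pinv_mul_mul (linearIndependent_unfoldAngle_col hΓ hcols) hcols
      (card_prod_eq_card_coe hΓ) _ (isUnit_one.kronecker (isUnit_midProd hQ.isUnit β)),
      inv_one_kronecker, ← Matrix.mul_kronecker_mul, Matrix.one_mul]
  rw [IsProbe, sliceα, sliceβ, sliceα', sliceβ', slice_observe hd, slice_observe hd,
    slice_observe hd, slice_observe hd, hquot s.card_Γ, hquot s.card_Γ']

theorem coreProd_eq [NeZero r] (hd : 2 ≤ d) (hQ : IsRegular Q)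
    {G₀ G₁ : Matrix (Fin r) (Fin r) ℂ} (h₀ : IsUnit G₀) (h₁ : IsUnit G₁)
    (h : ∀ a, firstCore E E' a = G₀⁻¹ * Q a * G₁) (i : Fin d → Fin n) :
    s.coreProd (s.observe (symTensor d Q)) E E' i =
      G₀⁻¹ * (List.ofFn fun k => Q (i k)).prod * G₀ := by
  obtain ⟨e, rfl⟩ : ∃ e, d = e + 2 := ⟨d - 2, by omega⟩
  have hm := hQ.isUnit s.m
  have hN : s.sliceγ (s.observe (symTensor (e + 2) Q)) = unfoldAngle Q *
      ((1 : Matrix (Fin r) (Fin r) ℂ) ⊗ₖ (Q s.m ^ e) * squareCols Q s.Γγ) := by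
    rw [sliceγ, slice_observe hd, midProd, List.ofFn_const, List.prod_replicate]
    rfl
  have hloop := fun k =>
    (coreLoop_eq s.card_Γγ (hQ.linearIndependent _ s.card_Γγ) hm h₀ h₁ h hN k).1
  have hprod := prod_ofFn_gauge (isUnit_gaugeSeq (e := e) hm h₀ h₁) fun k => Q (i k)
  rw [gaugeSeq_add_two hm] at hprod
  simp only [coreProd, cores, hloop]
  exact hprod

theorem exists_coreProd_probeBasis_eq [NeZero r] (hd : 2 ≤ d) (hQ : IsRegular Q)
    (s : Sampling n d r) {U V : Matrix (Fin r) (Fin r) ℂ}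
    {K K' : Fin r → Matrix (Fin r) (Fin r) ℂ} (hU : IsUnit U) (hK : ∀ t, IsUnit (K t))
    (hK' : ∀ t, IsUnit (K' t)) (hW : ∀ t, (U⁻¹ * V) t 0 ≠ 0) :
    ∃ G : Matrix (Fin r) (Fin r) ℂ, IsUnit G ∧ ∀ i : Fin d → Fin n,
      s.coreProd (s.observe (symTensor d Q)) (probeBasis (unfoldAngle Q) U K)
          (probeBasis (unfoldAngle Q) V K') i =
        G⁻¹ * (List.ofFn fun k => Q (i k)).prod * G := by
  have hA := linearIndependent_unfoldAngle_col s.card_Γ (hQ.linearIndependent _ s.card_Γ)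
  have hD : IsUnit (Matrix.diagonal fun t => (U⁻¹ * V) t 0 / (U⁻¹ * V) 0 0) := by
    rw [Matrix.isUnit_iff_isUnit_det, Matrix.det_diagonal, isUnit_iff_ne_zero,
      Finset.prod_ne_zero_iff]
    exact fun t _ => div_ne_zero (hW t) (hW 0)
  have hK0 : IsUnit (K 0)ᵀ := (Matrix.isUnit_transpose _).2 (hK 0)
  have hG := Matrix.isUnit_nonsing_inv_iff.2 hK0
  refine ⟨(K 0)ᵀ⁻¹, hG, coreProd_eq hd hQ hG (hU.mul hD) fun a => ?_⟩
  rw [Matrix.nonsing_inv_nonsing_inv _ ((Matrix.isUnit_iff_isUnit_det _).1 hK0),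
    firstCore_probeBasis hA hU hK hK' hW]

end Sampling

/-! ### Gauge equivalence -/

section CyclicGauge

variable {M ι : Type*} [Monoid M] {d : ℕ}

theorem prod_ofFn_ite_mul_pow (f : ι → M) (a m : ι) (k : Fin d) :
    (List.ofFn fun j => f (if j = k then a else m)).prod * f m ^ (k.val + 1) =
      f m ^ k.val * f a * f m ^ d := by
  induction d with
  | zero => exact k.elim0
  | succ d ih =>
    rw [List.ofFn_succ, List.prod_cons]
    refine Fin.cases ?_ (fun k => ?_) k
    · simp [Fin.succ_ne_zero, pow_succ, mul_assoc]
    · have hk := ih k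
      simp only [Fin.succ_inj, Fin.val_succ, (Fin.succ_ne_zero k).symm, if_false]
      rw [pow_succ (f m) (k.val + 1), mul_assoc, ← mul_assoc (List.prod _), hk, pow_succ (f m) d,
        pow_succ' (f m) k.val]
      simp only [mul_assoc]

/-- The gauge `z⁻ᵏ g cᵏ` that carries the tuple with the constant entry `z` to the tuple with the
constant entry `c`. -/
def cyclicGauge (z c g : Mˣ) (k : ℕ) : Mˣ := (z ^ k)⁻¹ * g * c ^ k

theorem cyclicGauge_of_pow_mul_eq {z c g : Mˣ} (h : z ^ d * g = g * c ^ d) :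
    cyclicGauge z c g d = cyclicGauge z c g 0 := by
  rw [cyclicGauge, cyclicGauge, mul_assoc, ← h, inv_mul_cancel_left, pow_zero, pow_zero, inv_one,
    one_mul, mul_one]

theorem apply_finRotate_val {α : Type*} {L : ℕ → α} (h : L d = L 0) (k : Fin d) :
    L (finRotate d k).val = L (k.val + 1) := by
  cases d with
  | zero => exact k.elim0
  | succ d =>
    by_cases hk : k = Fin.last d
    · rw [hk, finRotate_last, Fin.val_last]
      exact h.symm
    · rw [coe_finRotate_of_ne_last hk]

theorem eq_cyclicGauge_conj {f f' : ι → M} {m : ι} {z c g : Mˣ} (hz : f m = z) (hc : f' m = c)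
    (hpow : z ^ d * g = g * c ^ d)
    (h : ∀ i : Fin d → ι, (↑g⁻¹ : M) * (List.ofFn fun k => f (i k)).prod * g =
      (List.ofFn fun k => f' (i k)).prod) (k : Fin d) (a : ι) :
    f' a = (↑(cyclicGauge z c g k.val)⁻¹ : M) * f a * (cyclicGauge z c g (k.val + 1) : M) := by
  have hf : (List.ofFn fun j => f (if j = k then a else m)).prod =
      (↑(z ^ k.val) : M) * f a * ↑(z ^ d * (z ^ (k.val + 1))⁻¹) := by
    have hprod := prod_ofFn_ite_mul_pow f a m k
    rw [hz, ← Units.val_pow_eq_pow_val, ← Units.eq_mul_inv_iff_mul_eq] at hprod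
    simpa only [Units.val_mul, mul_assoc, Units.val_pow_eq_pow_val] using hprod
  have hf' : (↑(c ^ k.val) : M) * f' a * ↑(c ^ d) =
      (List.ofFn fun j => f' (if j = k then a else m)).prod * ↑(c ^ (k.val + 1)) := by
    have hprod := prod_ofFn_ite_mul_pow f' a m k
    rw [hc] at hprod
    exact_mod_cast hprod.symm
  have htail : z ^ d * (z ^ (k.val + 1))⁻¹ * g * c ^ (k.val + 1) =
      cyclicGauge z c g (k.val + 1) * c ^ d := by
    rw [cyclicGauge, ((Commute.refl z).pow_pow d (k.val + 1)).inv_right.eq, mul_assoc _ _ g, hpow,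
      mul_assoc, mul_assoc, mul_assoc, ((Commute.refl c).pow_pow d (k.val + 1)).eq]
    simp only [mul_assoc]
  have hhead : (cyclicGauge z c g k.val)⁻¹ = (c ^ k.val)⁻¹ * (g⁻¹ * z ^ k.val) := by
    rw [cyclicGauge, _root_.mul_inv_rev, _root_.mul_inv_rev, inv_inv]
  rw [← (c ^ k.val).mul_right_inj, ← (c ^ d).mul_left_inj, hf', ← h, hf, hhead]
  calc (↑g⁻¹ : M) * (↑(z ^ k.val) * f a * ↑(z ^ d * (z ^ (k.val + 1))⁻¹)) * g * ↑(c ^ (k.val + 1))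
      = ↑(g⁻¹ * z ^ k.val) * f a * ↑(z ^ d * (z ^ (k.val + 1))⁻¹ * g * c ^ (k.val + 1)) := by
        simp only [Units.val_mul, mul_assoc]
    _ = _ := by rw [htail]; simp only [Units.val_mul, mul_assoc, Units.mul_inv_cancel_left]

theorem exists_units_conj_of_prod_eq {f f' : ι → M} {m : ι} (hd : d ≠ 0) (hm : IsUnit (f m))
    (g : Mˣ) (h : ∀ i : Fin d → ι, (↑g⁻¹ : M) * (List.ofFn fun k => f (i k)).prod * g =
      (List.ofFn fun k => f' (i k)).prod) :
    ∃ L : Fin d → Mˣ, ∀ k a, f' a = (↑(L k)⁻¹ : M) * f a * (L (finRotate d k) : M) := by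
  have hpow := h fun _ => m
  simp only [List.ofFn_const, List.prod_replicate] at hpow
  obtain ⟨z, hz⟩ := hm
  obtain ⟨c, hc⟩ : IsUnit (f' m) := by
    rw [← isUnit_pow_iff hd, ← hpow, ← hz]
    exact (g⁻¹.isUnit.mul (z.isUnit.pow d)).mul g.isUnit
  have hzc : z ^ d * g = g * c ^ d := by
    ext
    push_cast
    rw [hz, hc, ← hpow, mul_assoc, Units.mul_inv_cancel_left]
  refine ⟨fun k => cyclicGauge z c g k.val, fun k a => ?_⟩
  dsimp only
  rw [apply_finRotate_val (cyclicGauge_of_pow_mul_eq hzc)]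
  exact eq_cyclicGauge_conj hz.symm hc.symm hzc h k a

end CyclicGauge

theorem Sampling.isUnit_candidateHead_iff {d r : ℕ} (hd : d ≠ 0)
    {H Y : Matrix (Fin r) (Fin r) ℂ} {ev : Fin r → ℂ} (h : IsEigendecomposition H Y ev)
    (k : Fin r → Fin d) : IsUnit (candidateHead d Y ev k) ↔ IsUnit H := by
  have hhead : IsEigendecomposition (candidateHead d Y ev k) Y
      fun t => dthRoot d (ev t) (k t).val := ⟨h.1, rfl⟩
  rw [hhead.isUnit_iff, h.isUnit_iff]
  refine forall_congr' fun t => ?_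
  rw [← pow_ne_zero_iff hd, dthRoot_pow hd]

namespace Sampling.Run

variable {n d r : ℕ} [NeZero n] [NeZero r] {s : Sampling n d r} {D : s.Data}

theorem coreProd_zero_ne_zero (hd : d ≠ 0) (R : s.Run D) :
    s.coreProd D R.E R.E' (fun _ => 0) ≠ 0 :=
  ((isUnit_candidateHead_iff hd R.eigen R.k).1 R.head_invertible).ne_zero

theorem inv_mul_apply_zero_ne_zero (hd : d ≠ 0) (hr : 2 ≤ r) {R : s.Run D}
    {A : Matrix (Fin n) (Fin r × Fin r) ℂ} (hA : LinearIndependent ℂ A.col)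
    {U V : Matrix (Fin r) (Fin r) ℂ} {K K' : Fin r → Matrix (Fin r) (Fin r) ℂ} (hU : IsUnit U)
    (hK : ∀ t, IsUnit (K t)) (hK' : ∀ t, IsUnit (K' t)) (hE : R.E = probeBasis A U K)
    (hE' : R.E' = probeBasis A V K') (t : Fin r) : (U⁻¹ * V) t 0 ≠ 0 := by
  obtain rfl | ht := eq_or_ne t 0
  · intro h0
    have hfirst : firstCore R.E R.E' = 0 := firstCore_eq_zero hr (by
      rw [hE, hE', probeBlock_probeBasis hA hU hK, h0, zero_smul])
    refine R.coreProd_zero_ne_zero hd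
      (List.prod_eq_zero (List.mem_ofFn.2 ⟨⟨0, Nat.pos_of_ne_zero hd⟩, ?_⟩))
    simp only [cores, coreLoop, hfirst, Pi.zero_apply]
  · rw [← isUnit_probeBlock_probeBasis_iff hA hU hK hK', ← hE, ← hE']
    exact R.probe_invertible t ht

theorem gaugeEquiv_output (hd : 2 ≤ d) (hr : 2 ≤ r) {Q : Core n r} (hQ : IsRegular Q)
    (R : s.Run (s.observe (symTensor d Q))) :
    GaugeEquiv (fun _ : Fin d => Q) (fun _ : Fin d => R.output) := by
  have hd0 : d ≠ 0 := by omega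
  have hA := linearIndependent_unfoldAngle_col s.card_Γ (hQ.linearIndependent _ s.card_Γ)
  obtain ⟨hprobe, hprobe'⟩ := (isProbe_iff hd hQ).1 R.probe
  obtain ⟨U, -, K, ⟨hU, -⟩, -, hK, hE⟩ := hprobe.exists_eq_probeBasis hA
  obtain ⟨V, -, K', -, -, hK', hE'⟩ := hprobe'.exists_eq_probeBasis hA
  have hW := inv_mul_apply_zero_ne_zero hd0 hr hA hU hK hK' hE hE'
  obtain ⟨G, hG, hprod⟩ := exists_coreProd_probeBasis_eq hd hQ s hU hK hK' hW
  obtain ⟨g, rfl⟩ := hG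
  refine exists_units_conj_of_prod_eq hd0 (hQ.isUnit s.m) g fun i => ?_
  rw [Matrix.coe_units_inv, ← hprod, ← hE, ← hE']
  exact R.accepts i

end Sampling.Run

/-! ### Completion -/

namespace Sampling

variable {n d r : ℕ} {Q : Core n r}

theorem exists_isProbe (hd : 2 ≤ d) (hQ : IsRegular Q) (s : Sampling n d r)
    (hs : InGeneralPosition (midProd Q s.α * (midProd Q s.β)⁻¹)
      (midProd Q s.α' * (midProd Q s.β')⁻¹)) :
    ∃ E E', s.IsProbe (s.observe (symTensor d Q)) E E' := by
  have hA := linearIndependent_unfoldAngle_col s.card_Γ (hQ.linearIndependent _ s.card_Γ)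
  have hunit : ∀ α β : Fin (d - 2) → Fin n, IsUnit (midProd Q α * (midProd Q β)⁻¹) := fun α β =>
    (isUnit_midProd hQ.isUnit α).mul (Matrix.isUnit_nonsing_inv_iff.2 (isUnit_midProd hQ.isUnit β))
  obtain ⟨U, V, u, v, hU, hu, hV, hv, -⟩ := hs
  exact ⟨_, _, (isProbe_iff hd hQ).2
    ⟨hU.isEigenbasis hA hu (hU.isUnit_iff.1 (hunit _ _)),
      hV.isEigenbasis hA hv (hV.isUnit_iff.1 (hunit _ _))⟩⟩

variable [NeZero r] {s : Sampling n d r} {E E' : Matrix (Fin n) (Fin r × Fin r) ℂ}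

theorem exists_coreProd_eq_conj (hd : 2 ≤ d) (hQ : IsRegular Q)
    (hs : InGeneralPosition (midProd Q s.α * (midProd Q s.β)⁻¹)
      (midProd Q s.α' * (midProd Q s.β')⁻¹))
    (hE : s.IsProbe (s.observe (symTensor d Q)) E E') :
    ProbeInvertible E E' ∧ ∃ G : (Matrix (Fin r) (Fin r) ℂ)ˣ,
      ∀ i, s.coreProd (s.observe (symTensor d Q)) E E' i =
        (List.ofFn fun k => (↑G⁻¹ : Matrix (Fin r) (Fin r) ℂ) * Q (i k) * G).prod := by
  have hA := linearIndependent_unfoldAngle_col s.card_Γ (hQ.linearIndependent _ s.card_Γ)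
  obtain ⟨hprobe, hprobe'⟩ := (isProbe_iff hd hQ).1 hE
  obtain ⟨U, u, K, hU, hu, hK, rfl⟩ := hprobe.exists_eq_probeBasis hA
  obtain ⟨V, v, K', hV, hv, hK', rfl⟩ := hprobe'.exists_eq_probeBasis hA
  have hW := fun t => hs.inv_mul_apply_ne_zero hU hu hV hv t 0
  refine ⟨fun t _ => (isUnit_probeBlock_probeBasis_iff hA hU.1 hK hK' t 0).2 (hW t), ?_⟩
  obtain ⟨_, ⟨G, rfl⟩, hprod⟩ := exists_coreProd_probeBasis_eq hd hQ s hU.1 hK hK' hW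
  refine ⟨G, fun i => ?_⟩
  rw [hprod, Matrix.coe_units_inv]
  exact (prod_ofFn_gauge (G := fun _ => (G : Matrix (Fin r) (Fin r) ℂ))
    (fun _ => G.isUnit) fun k => Q (i k)).symm

theorem exists_candidateHead_eq (hd : d ≠ 0) {M Y : Matrix (Fin r) (Fin r) ℂ} {ev : Fin r → ℂ}
    (hM : IsUnit M) (hY : IsEigendecomposition (M ^ d) Y ev) (hev : Function.Injective ev) :
    ∃ (k : Fin r → Fin d) (c : ℂ), (k 0).val = 0 ∧ c ^ d = 1 ∧ candidateHead d Y ev k = c • M := by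
  obtain ⟨ω, hω⟩ := hY.exists_of_commute hev (Commute.self_pow M d)
  have hω0 := hω.isUnit_iff.1 hM
  obtain rfl : ev = ω ^ d := hY.eigenvalues_unique (hω.pow d)
  -- The search fixes the first root, so `M` is only found up to the root of unity `c`.
  let c := dthRoot d ((ω ^ d) 0) 0 / ω 0
  have hc : c ^ d = 1 := by
    rw [div_pow, dthRoot_pow hd, Pi.pow_apply, div_self (pow_ne_zero d (hω0 0))]
  have hroot : ∀ t, ∃ k : Fin d, (t = 0 → k.val = 0) ∧ dthRoot d ((ω ^ d) t) k.val = c * ω t := by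
    intro t
    by_cases ht : t = 0
    · subst ht
      exact ⟨⟨0, Nat.pos_of_ne_zero hd⟩, fun _ => rfl, (div_mul_cancel₀ _ (hω0 0)).symm⟩
    · obtain ⟨k, hk⟩ := exists_dthRoot_eq hd (z := (ω ^ d) t) (w := c * ω t)
        (pow_ne_zero d (hω0 t)) (by rw [mul_pow, hc, one_mul, Pi.pow_apply])
      exact ⟨k, fun h => absurd h ht, hk⟩
  choose k hk0 hk using hroot
  refine ⟨k, c, hk0 0 rfl, hc, ?_⟩
  rw [candidateHead, funext hk]
  exact (hω.smul c).2.symm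

variable [NeZero n] {D : s.Data} {C : Core n r} {Y : Matrix (Fin r) (Fin r) ℂ} {ev : Fin r → ℂ}
  {k : Fin r → Fin d} {c : ℂ}

theorem candidate_eq_smul (hd : d ≠ 0) (h0 : IsUnit (C 0))
    (hprod : ∀ i, s.coreProd D E E' i = (List.ofFn fun k => C (i k)).prod) (hc : c ^ d = 1)
    (hhead : candidateHead d Y ev k = c • C 0) (j : Fin n) :
    s.candidate D E E' Y ev k j = c • C j := by
  obtain ⟨e, rfl⟩ := Nat.exists_eq_succ_of_ne_zero hd
  have hc0 : c ≠ 0 := (pow_ne_zero_iff hd).1 (hc ▸ one_ne_zero)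
  rw [candidate]
  split_ifs with hj
  · rw [hj, hhead]
  have hlast : s.coreProd D E E' (fun t => if t.val = e then j else 0) = C 0 ^ e * C j := by
    rw [hprod, List.ofFn_succ', List.concat_eq_append, List.prod_append, List.prod_singleton]
    simp [fun t : Fin e => t.isLt.ne, List.ofFn_const, List.prod_replicate]
  have hsplit : C 0 ^ e * C j = (c • C 0) ^ e * (c • C j) := by
    rw [smul_pow, smul_mul_smul_comm, ← pow_succ, hc, one_smul]
  have hunit : IsUnit ((c • C 0) ^ e) := (h0.smul (Units.mk0 c hc0)).pow e
  rw [Nat.succ_sub_one, hhead, hlast, hsplit,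
    Matrix.nonsing_inv_mul_cancel_left _ _ ((Matrix.isUnit_iff_isUnit_det _).1 hunit)]

theorem accepts_candidate (hd : d ≠ 0) (h0 : IsUnit (C 0))
    (hprod : ∀ i, s.coreProd D E E' i = (List.ofFn fun k => C (i k)).prod) (hc : c ^ d = 1)
    (hhead : candidateHead d Y ev k = c • C 0) :
    s.Accepts D E E' (s.candidate D E E' Y ev k) := by
  intro i
  have hsmul := List.smul_prod (List.ofFn fun t => C (i t)) c
  rw [List.length_ofFn, hc, one_smul, List.map_ofFn] at hsmul
  rw [hprod, hsmul]
  exact congrArg (fun l => (List.ofFn l).prod)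
    (funext fun t => (candidate_eq_smul hd h0 hprod hc hhead (i t)).symm)

theorem exists_accepts_candidate (hd : d ≠ 0) (h0 : IsUnit (C 0))
    (hspec : (C 0 ^ d).charpoly.Separable)
    (hprod : ∀ i, s.coreProd D E E' i = (List.ofFn fun k => C (i k)).prod)
    (hY : IsEigendecomposition (C 0 ^ d) Y ev) :
    ∃ k : Fin r → Fin d, (k 0).val = 0 ∧ s.Accepts D E E' (s.candidate D E E' Y ev k) := by
  obtain ⟨k, c, hk, hc, hhead⟩ :=
    exists_candidateHead_eq hd h0 hY (hY.separable_charpoly_iff.1 hspec)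
  exact ⟨k, hk, accepts_candidate hd h0 hprod hc hhead⟩

theorem completes_of_isRegular (hd : 2 ≤ d) (hQ : IsRegular Q) (s : Sampling n d r)
    (hspec : (Q 0 ^ d).charpoly.Separable)
    (hs : InGeneralPosition (midProd Q s.α * (midProd Q s.β)⁻¹)
      (midProd Q s.α' * (midProd Q s.β')⁻¹)) :
    s.Completes (s.observe (symTensor d Q)) := by
  refine ⟨exists_isProbe hd hQ s hs, fun E E' hE => ?_⟩
  obtain ⟨hinv, G, hprod⟩ := exists_coreProd_eq_conj hd hQ hs hE
  let C : Core n r := fun a => (↑G⁻¹ : Matrix (Fin r) (Fin r) ℂ) * Q a * G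
  have hC0 : IsUnit (C 0) := (G⁻¹.isUnit.mul (hQ.isUnit 0)).mul G.isUnit
  have hCpow : (C 0 ^ d).charpoly.Separable := by
    rwa [Units.conj_pow', Matrix.coe_units_inv, Matrix.charpoly_units_conj']
  have hhead : s.coreProd (s.observe (symTensor d Q)) E E' (fun _ => 0) = C 0 ^ d := by
    rw [hprod, List.ofFn_const, List.prod_replicate]
  have hd0 : d ≠ 0 := by omega
  rw [hhead]
  refine ⟨hinv, ?_, fun Y ev hY => ⟨fun k _ => ?_, ?_⟩⟩
  · obtain ⟨Y, ev, hY, -⟩ := exists_isEigendecomposition hCpow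
    exact ⟨Y, ev, hY⟩
  · exact (isUnit_candidateHead_iff hd0 hY k).2 (hC0.pow d)
  · exact exists_accepts_candidate hd0 hC0 hCpow hprod hY

end Sampling

/-! ### Generic cores -/

section Generic

variable {n d r : ℕ}

theorem ae_isUnit_slice (a : Fin n) :
    ∀ᵐ x : Fin n → Fin r → Fin r → ℂ, IsUnit (toCore x a) := by
  have heval (Q : Core n r) : evalCore Q (genericCore n r a).det = (Q a).det := by
    rw [RingHom.map_det, RingHom.mapMatrix_apply, map_genericCore]
  have hne : evalCore (1 : Core n r) (genericCore n r a).det ≠ 0 := by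
    rw [heval, Pi.one_apply, Matrix.det_one]
    exact one_ne_zero
  filter_upwards [ae_evalCore_ne_zero hne] with x hx
  rwa [Matrix.isUnit_iff_isUnit_det, isUnit_iff_ne_zero, ← heval]

theorem squareCols_single {Γ : Finset (Fin n)} (e : Γ ≃ Fin r × Fin r) :
    (squareCols (fun c => if h : c ∈ Γ then Matrix.single (e ⟨c, h⟩).2 (e ⟨c, h⟩).1 1 else 0)
      Γ).submatrix id e.symm = 1 := by
  ext p q
  simp only [squareCols, unfoldSquare, Matrix.submatrix_apply, Matrix.transpose_apply, id,
    Matrix.of_apply, Finset.coe_mem, dif_pos, Subtype.coe_eta, Equiv.apply_symm_apply,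
    Matrix.single_apply, Matrix.one_apply, Prod.ext_iff]
  simp only [eq_comm, and_comm]

theorem ae_linearIndependent_squareCols {Γ : Finset (Fin n)} (hΓ : Γ.card = r ^ 2) :
    ∀ᵐ x : Fin n → Fin r → Fin r → ℂ, LinearIndependent ℂ (squareCols (toCore x) Γ).col := by
  let e : Γ ≃ Fin r × Fin r := (Fintype.equivOfCardEq (card_prod_eq_card_coe hΓ)).symm
  let P := (Matrix.of fun p q : Fin r × Fin r => genericCore n r (e.symm q).val p.2 p.1).det
  have heval (Q : Core n r) : evalCore Q P = ((squareCols Q Γ).submatrix id e.symm).det := by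
    rw [RingHom.map_det]
    congr 1
    ext p q
    exact congrFun (congrFun (map_genericCore Q (e.symm q).val) p.2) p.1
  have hne := heval fun c => if h : c ∈ Γ then Matrix.single (e ⟨c, h⟩).2 (e ⟨c, h⟩).1 1 else 0
  rw [squareCols_single, Matrix.det_one] at hne
  filter_upwards [ae_evalCore_ne_zero (hne ▸ one_ne_zero)] with x hx
  rw [heval, ← isUnit_iff_ne_zero, ← Matrix.isUnit_iff_isUnit_det,
    ← Matrix.linearIndependent_cols_iff_isUnit] at hx
  exact (linearIndependent_equiv e.symm).1 hx

theorem ae_isRegular (n r : ℕ) : ∀ᵐ x : Fin n → Fin r → Fin r → ℂ, IsRegular (toCore x) := by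
  filter_upwards [ae_all_iff.2 ae_isUnit_slice, ae_all_iff.2 fun Γ => ae_all_iff.2 fun hΓ =>
    ae_linearIndependent_squareCols (n := n) (r := r) (Γ := Γ) hΓ] with x hx hx'
  exact ⟨hx, hx'⟩

theorem isEigendecomposition_diagonal (u : Fin r → ℂ) :
    IsEigendecomposition (Matrix.diagonal u) 1 u :=
  isEigendecomposition_of_mul_eq isUnit_one (by rw [Matrix.mul_one, Matrix.one_mul])

theorem ae_separable_charpoly_pow (hd : d ≠ 0) (a : Fin n) :
    ∀ᵐ x : Fin n → Fin r → Fin r → ℂ, (toCore x a ^ d).charpoly.Separable := by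
  have heval (Q : Core n r) :
      evalCore Q (charpolyDiscr (genericCore n r a ^ d)) = charpolyDiscr (Q a ^ d) := by
    rw [map_charpolyDiscr, Matrix.map_pow, map_genericCore]
  have hne : evalCore (fun _ => Matrix.diagonal fun t : Fin r => (t.val : ℂ) : Core n r)
      (charpolyDiscr (genericCore n r a ^ d)) ≠ 0 := by
    rw [heval, charpolyDiscr_ne_zero_iff,
      ((isEigendecomposition_diagonal _).pow d).separable_charpoly_iff]
    intro i j hij
    simp only [Pi.pow_apply] at hij
    exact Fin.ext (Nat.pow_left_injective hd (by exact_mod_cast hij))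
  filter_upwards [ae_evalCore_ne_zero hne] with x hx
  rwa [← charpolyDiscr_ne_zero_iff, ← heval]

namespace Sampling

theorem map_prod_mul_adjugate_genericCore (Q : Core n r) (α β : Fin (d - 2) → Fin n) :
    ((List.ofFn fun k => genericCore n r (α k)).prod *
      (List.ofFn fun k => genericCore n r (β k)).prod.adjugate).map (evalCore Q) =
      midProd Q α * (midProd Q β).adjugate := by
  have hprod (α : Fin (d - 2) → Fin n) : (evalCore Q).mapMatrix
      (List.ofFn fun k => genericCore n r (α k)).prod = midProd Q α := by
    rw [map_list_prod, List.map_ofFn, midProd]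
    exact congrArg (fun l => (List.ofFn l).prod) (funext fun k => map_genericCore Q (α k))
  rw [← RingHom.mapMatrix_apply, map_mul, RingHom.map_adjugate, hprod, hprod]

theorem Nondegenerate.ae_inGeneralPosition {s : Sampling n d r} (hs : s.Nondegenerate) :
    ∀ᵐ x : Fin n → Fin r → Fin r → ℂ,
      InGeneralPosition (midProd (toCore x) s.α * (midProd (toCore x) s.β)⁻¹)
        (midProd (toCore x) s.α' * (midProd (toCore x) s.β')⁻¹) := by
  obtain ⟨Q, U, V, u, v, hβ, hβ', hQ⟩ := hs
  let P := generalPositionDet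
    ((List.ofFn fun k => genericCore n r (s.α k)).prod *
      (List.ofFn fun k => genericCore n r (s.β k)).prod.adjugate)
    ((List.ofFn fun k => genericCore n r (s.α' k)).prod *
      (List.ofFn fun k => genericCore n r (s.β' k)).prod.adjugate)
  have heval (Q : Core n r) (hβ : IsUnit (midProd Q s.β)) (hβ' : IsUnit (midProd Q s.β')) :
      evalCore Q P ≠ 0 ↔ InGeneralPosition (midProd Q s.α * (midProd Q s.β)⁻¹)
        (midProd Q s.α' * (midProd Q s.β')⁻¹) := by
    rw [map_generalPositionDet, map_prod_mul_adjugate_genericCore,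
      map_prod_mul_adjugate_genericCore, generalPositionDet_ne_zero_iff,
      inGeneralPosition_mul_adjugate_iff hβ hβ']
  filter_upwards [ae_isRegular n r, ae_evalCore_ne_zero ((heval Q hβ hβ').2 ⟨U, V, u, v, hQ⟩)]
    with x hreg hx
  exact (heval _ (isUnit_midProd hreg.isUnit _) (isUnit_midProd hreg.isUnit _)).1 hx

theorem Nondegenerate.ae_completes [NeZero n] [NeZero r] (hd : 2 ≤ d) {s : Sampling n d r}
    (hs : s.Nondegenerate) :
    ∀ᵐ x : Fin n → Fin r → Fin r → ℂ, s.Completes (s.observe (symTensor d (toCore x))) := by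
  have hd0 : d ≠ 0 := by omega
  filter_upwards [ae_isRegular n r, ae_separable_charpoly_pow hd0 0, hs.ae_inGeneralPosition]
    with x hreg hspec hpos
  exact completes_of_isRegular hd hreg s hspec hpos

end Sampling

end Generic

/-! ### Sampling choices -/

section Quotients

variable {ι G : Type*} [Group G] {a b a' b' : ι}

theorem exists_mul_inv_eq_of_ne (hab : a ≠ b) (ha : a' ≠ a) (hb : a' ≠ b) (hab' : a' ≠ b')
    (A B : G) : ∃ q : ι → G, q a * (q b)⁻¹ = A ∧ q a' * (q b')⁻¹ = B := by
  classical
  refine ⟨Function.update (Pi.mulSingle a A) a' (B * Pi.mulSingle (M := fun _ => G) a A b'),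
    ?_, ?_⟩
  · rw [Function.update_of_ne ha.symm, Function.update_of_ne hb.symm, Pi.mulSingle_eq_same,
      Pi.mulSingle_eq_of_ne hab.symm, inv_one, mul_one]
  · rw [Function.update_self, Function.update_of_ne hab'.symm, mul_inv_cancel_right]

theorem exists_mul_inv_eq_of_pair_ne (hab : a ≠ b) (hab' : a' ≠ b')
    (hne : ({a, b} : Set ι) ≠ {a', b'}) (A B : G) :
    ∃ q : ι → G, q a * (q b)⁻¹ = A ∧ q a' * (q b')⁻¹ = B := by
  rw [Ne, Set.pair_eq_pair_iff] at hne
  obtain ⟨ha, hb⟩ | ⟨ha, hb⟩ : (a' ≠ a ∧ a' ≠ b) ∨ (b' ≠ a ∧ b' ≠ b) := by grind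
  · exact exists_mul_inv_eq_of_ne hab ha hb hab' A B
  · obtain ⟨q, hA, hB⟩ := exists_mul_inv_eq_of_ne hab ha hb hab'.symm A B⁻¹
    exact ⟨q, hA, by rw [← _root_.inv_inj, ← hB, _root_.mul_inv_rev, inv_inv]⟩

end Quotients

theorem exists_inGeneralPosition (r : ℕ) : ∃ A B : (Matrix (Fin r) (Fin r) ℂ)ˣ,
    InGeneralPosition (A : Matrix (Fin r) (Fin r) ℂ) (B : Matrix (Fin r) (Fin r) ℂ) := by
  let u : Fin r → ℂ := fun t => (t.val : ℂ) + 1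
  have hu : Function.Injective u := fun i j hij => by
    have : (i.val : ℂ) = j.val := add_right_cancel hij
    exact Fin.ext (by exact_mod_cast this)
  have hu0 : ∀ t, u t ≠ 0 := fun t => Nat.cast_add_one_ne_zero t.val
  have hD := isEigendecomposition_diagonal u
  have hvandermonde : IsUnit (Matrix.vandermonde u) := by
    rw [Matrix.isUnit_iff_isUnit_det, isUnit_iff_ne_zero]
    exact Matrix.det_vandermonde_ne_zero_iff.2 hu
  have hV : IsEigendecomposition
      (Matrix.vandermonde u * Matrix.diagonal u * (Matrix.vandermonde u)⁻¹)
      (Matrix.vandermonde u) u := ⟨hvandermonde, rfl⟩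
  refine ⟨(hD.isUnit_iff.2 hu0).unit, (hV.isUnit_iff.2 hu0).unit, 1, Matrix.vandermonde u, u, u,
    hD, hu, hV, hu, fun i j => ?_⟩
  rw [inv_one, Matrix.one_mul, Matrix.vandermonde_apply]
  exact pow_ne_zero _ (hu0 i)

namespace Sampling

variable {n d r : ℕ}

theorem midProd_mul_inv_midProd (hd : 3 ≤ d) {Q : Core n r} (hQ : ∀ a, IsUnit (Q a))
    {α β : Fin (d - 2) → Fin n} (h : ∀ i : Fin (d - 2), i.val ≠ 0 → α i = β i) :
    midProd Q α * (midProd Q β)⁻¹ = Q (α ⟨0, by omega⟩) * (Q (β ⟨0, by omega⟩))⁻¹ := by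
  obtain ⟨e, rfl⟩ : ∃ e, d = e + 3 := ⟨d - 3, by omega⟩
  have hsplit (α : Fin (e + 1) → Fin n) : midProd (d := e + 3) Q α =
      Q (α 0) * (List.ofFn fun k : Fin e => Q (α k.succ)).prod :=
    congrArg List.prod List.ofFn_succ
  have htail : (fun k : Fin e => Q (β k.succ)) = fun k => Q (α k.succ) :=
    funext fun k => by rw [h k.succ (Nat.succ_ne_zero k)]
  have hunit := (Matrix.isUnit_iff_isUnit_det _).1 (isUnit_prod_ofFn fun k : Fin e => hQ (α k.succ))
  rw [hsplit α, hsplit β, htail, Matrix.mul_inv_rev, Matrix.mul_assoc,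
    Matrix.mul_nonsing_inv_cancel_left _ _ hunit]
  rfl

theorem DiffersInFirst.nondegenerate (hd : 3 ≤ d) {s : Sampling n d r} (hs : s.DiffersInFirst) :
    s.Nondegenerate := by
  obtain ⟨htail, hpair⟩ := hs
  have hfirst {α β : Fin (d - 2) → Fin n} (hne : α ≠ β)
      (h : ∀ i : Fin (d - 2), i.val ≠ 0 → α i = β i) : α ⟨0, by omega⟩ ≠ β ⟨0, by omega⟩ := by
    intro h0
    refine hne (funext fun i => ?_)
    by_cases hi : i.val = 0
    · rwa [show i = ⟨0, by omega⟩ from Fin.ext hi]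
    · exact h i hi
  obtain ⟨A, B, U, V, u, v, hAB⟩ := exists_inGeneralPosition r
  obtain ⟨q, hA, hB⟩ := exists_mul_inv_eq_of_pair_ne
    (hfirst s.ne fun i hi => (htail i hi).1) (hfirst s.ne' fun i hi => (htail i hi).2)
    (hpair ⟨0, by omega⟩ rfl) A B
  let Q : Core n r := fun a => q a
  have hQ (a : Fin n) : IsUnit (Q a) := (q a).isUnit
  have hα : midProd Q s.α * (midProd Q s.β)⁻¹ = A := by
    rw [midProd_mul_inv_midProd hd hQ fun i hi => (htail i hi).1, ← hA, Units.val_mul,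
      Matrix.coe_units_inv]
  have hα' : midProd Q s.α' * (midProd Q s.β')⁻¹ = B := by
    rw [midProd_mul_inv_midProd hd hQ fun i hi => (htail i hi).2, ← hB, Units.val_mul,
      Matrix.coe_units_inv]
  rw [← hα, ← hα'] at hAB
  exact ⟨Q, U, V, u, v, isUnit_midProd hQ _, isUnit_midProd hQ _, hAB⟩

theorem exists_differsInFirst (hd : 3 ≤ d) (hn : 3 ≤ n) (hrn : r ^ 2 ≤ n) :
    ∃ s : Sampling n d r, s.DiffersInFirst := by
  obtain ⟨Γ, -, hΓ⟩ := Finset.exists_subset_card_eq (s := (Finset.univ : Finset (Fin n)))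
    (n := r ^ 2) (by simpa using hrn)
  let c : Fin 3 → Fin n := Fin.castLE hn
  let α (t : Fin 3) (i : Fin (d - 2)) : Fin n := if i.val = 0 then c t else c 0
  have hc : Function.Injective c := Fin.castLE_injective hn
  have hα : Function.Injective α := fun t t' h => by
    refine hc ?_
    simpa only [α, if_true] using congrFun h ⟨0, by omega⟩
  have hpair {ι : Type} {f : Fin 3 → ι} (hf : Function.Injective f) :
      ({f 0, f 1} : Set ι) ≠ {f 0, f 2} := by
    rw [Ne, Set.pair_eq_pair_iff, not_or]
    exact ⟨fun h => hf.ne (by decide) h.2, fun h => hf.ne (by decide) h.2⟩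
  refine ⟨⟨α 0, α 1, α 0, α 2, c 0, Γ, Γ, Γ, hΓ, hΓ, hΓ, hα.ne (by decide), hα.ne (by decide),
    hpair hα⟩, fun i hi => ?_, fun i hi => ?_⟩
  · simp only [α, hi, if_false, and_self]
  · simp only [α, hi, if_true]
    exact hpair hc

theorem card_block_le (α : Fin (d - 2) → Fin n) (Γ : Finset (Fin n)) :
    (block d α Γ).card ≤ n * Γ.card := by
  refine Finset.card_image_le.trans_eq ?_
  rw [Finset.card_product, Finset.card_univ, Fintype.card_fin]

theorem card_positions_le (s : Sampling n d r) : s.positions.card ≤ 5 * (n * r ^ 2) := by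
  calc s.positions.card
    _ ≤ (block d s.α s.Γ).card + (block d s.β s.Γ).card +
        ((block d s.α' s.Γ').card + (block d s.β' s.Γ').card) +
        (block d (fun _ => s.m) s.Γγ).card := by
      unfold positions
      refine (Finset.card_union_le _ _).trans (Nat.add_le_add_right ?_ _)
      exact (Finset.card_union_le _ _).trans
        (Nat.add_le_add (Finset.card_union_le _ _) (Finset.card_union_le _ _))
    _ ≤ n * r ^ 2 + n * r ^ 2 + (n * r ^ 2 + n * r ^ 2) + n * r ^ 2 := by
      grw [card_block_le, card_block_le, card_block_le, card_block_le, card_block_le, s.card_Γ,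
        s.card_Γ', s.card_Γγ]
    _ = 5 * (n * r ^ 2) := by ring

end Sampling

end TensorRing

theorem theorem2 (n d r : ℕ) [NeZero n] [NeZero r] (hd : 3 ≤ d) (hr : 2 ≤ r) (hn : r ^ 2 ≤ n)
    (μ : MeasureTheory.Measure (Fin n → Fin r → Fin r → ℂ)) [MeasureTheory.IsProbabilityMeasure μ]
    (hμ : μ.AbsolutelyContinuous MeasureTheory.volume) :
    -- whatever is returned is the core, up to gauge
    (∀ᵐ x ∂μ, ∀ (s : TensorRing.Sampling n d r)
        (R : s.Run (s.observe (TensorRing.symTensor d (TensorRing.toCore x)))),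
        TensorRing.GaugeEquiv (fun _ : Fin d => TensorRing.toCore x) (fun _ : Fin d => R.output)) ∧
    -- the algorithm runs through and returns a core
    (∀ s : TensorRing.Sampling n d r, s.Nondegenerate →
      ∀ᵐ x ∂μ, s.Completes (s.observe (TensorRing.symTensor d (TensorRing.toCore x)))) ∧
    -- choices of the middle indices for which it does
    (∀ s : TensorRing.Sampling n d r, s.DiffersInFirst → s.Nondegenerate) ∧
    (∃ s : TensorRing.Sampling n d r, s.DiffersInFirst) ∧
    -- the number of entries that are read
    (∀ s : TensorRing.Sampling n d r, s.positions.card ≤ 5 * (n * r ^ 2)) := by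
  refine ⟨?_, fun s hs => hμ.ae_le (hs.ae_completes (by omega)), fun s hs => hs.nondegenerate hd,
    ?_, fun s => s.card_positions_le⟩
  · filter_upwards [hμ.ae_le (TensorRing.ae_isRegular n r)] with x hx s R
    exact R.gaugeEquiv_output (by omega) hr hx
  · have hn4 : 2 ^ 2 ≤ n := (Nat.pow_le_pow_left hr 2).trans hn
    exact TensorRing.Sampling.exists_differsInFirst hd (by omega) hn
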